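/- There are universal constants $C_1,C_2>0$ such that the following holds. Let $n,m\ge 1$, let $f:\mathbb R^n\to\mathbb R$ be convex and differentiable with $L_f$-Lipschitz gradient ($L_f\ge 0$), let $h:\mathbb R^m\to\mathbb R\cup\{+\infty\}$ be proper, closed and convex, let $A\in\mathbb R^{m\times n}$ have full row rank with smallest singular value $\sigma_{\min}$ and condition number $\kappa_A=\|A\|/\sigma_{\min}$, and let $b\in\mathbb R^m$. Put $F(x)=f(x)+h(Ax-b)$, suppose that $F$ has a minimizer $x^\star$, and let $x_0\in\mathbb R^n$ and $D>0$ satisfy $\|x_0-x^\star\|\le D$. Let $\lambda_0\in\mathbb R^m$, $\epsilon>0$ and $0<\rho<\infty$. Write $g^\star(y)=\sup_x\{x^{\mathsf T}y-g(x)\}$, $\mathrm{prox}_g(x)=\arg\min_u\{g(u)+\frac12\|x-u\|^2\}$ and $h_\rho(z)=\sup_{\|y\|\le\rho}\{z^{\mathsf T}y-h^\star(y)\}\in[-\infty,\infty)$. Consider the regularized problem with smooth part $f_\epsilon(x)=f(x)+\frac{\epsilon}{2D^2}\|x-x_0\|^2$, and put $\mu=\epsilon/D^2$, $L=L_f+\epsilon/D^2$,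 $\ell=\mu_\Phi=\sigma_{\min}^2/L$, $\delta_k=\bigl(1-\frac{\mu_\Phi}{12\ell}\bigr)^{k/2}D$. Algorithm 2 computes, for $k=1,\dots,T$, $$x_k=\mathsf{AGD}(\Psi_k,x_{k-1},\delta_k),\qquad \lambda_k=\lambda_k^\star(x_k),\qquad \lambda_k^\star(x)=\mathrm{prox}_{h^\star/\ell}\Bigl(\lambda_{k-1}+\tfrac{Ax-b}{\ell}\Bigr),$$ where $\Psi_k(x)=f_\epsilon(x)+g_k^\star(Ax-b)$, $g_k(\lambda)=h^\star(\lambda)+\frac{\ell}{2}\|\lambda-\lambda_{k-1}\|^2$, and returns $\hat x=x_T$. Here $\mathsf{AGD}(\Psi,y_0,\delta)$ is Nesterov's accelerated gradient descent with parameters $L_\Psi=L+\|A\|^2/\ell$ and $\mu$: with $y_{-1}=y_0$, $\kappa=L_\Psi/\mu$ and $\theta=\frac{\sqrt\kappa-1}{\sqrt\kappa+1}$ it iterates $\tilde y_{j+1}=y_j+\theta(y_j-y_{j-1})$, $y_{j+1}=\tilde y_{j+1}-\frac1{L_\Psi}\nabla\Psi(\tilde y_{j+1})$ and outputs the first $y_j$,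 $j\ge1$, with $\|\nabla\Psi(y_j)\|\le\mu\delta$. Each iteration counts as two gradient evaluations (at $\tilde y_{j+1}$, and at $y_{j+1}$ for the stopping test). Let $$\mathcal L=\log\Bigl(2+\kappa_A+\frac{L_fD^2}{\epsilon}+\frac{(\|\nabla f(x_0)\|+\rho\|A\|+\|A\|\|\lambda_0\|)D}{\epsilon}\Bigr),\qquad T=\lceil C_1\mathcal L\rceil .$$ Then: (i) for every $\lambda_{k-1}\in\mathbb R^m$ the function $\Psi_k$ is differentiable with $\nabla\Psi_k(x)=\nabla f(x)+\frac{\epsilon}{D^2}(x-x_0)+A^{\mathsf T}\lambda_k^\star(x)$ for all $x$, so one evaluation of $\nabla\Psi_k$ uses exactly one evaluation of $\nabla f$; (ii) each of the $T$ calls of $\mathsf{AGD}$ terminates; (iii) the output satisfies $f(\hat x)+h_\rho(A\hat x-b)-\min F\le\epsilon$; (iv) the total number $N$ of gradient evaluations satisfies $$N\le C_2\,\kappa_A\sqrt{\frac{L_fD^2}{\epsilon}+1}\;\mathcal L^2,\qquad\text{and, if }\epsilon\le L_fD^2,\qquad N\le C_2\,\frac{\kappa_A\sqrt{L_f}D}{\sqrt\epsilon}\,\mathcal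 L^2 .$$ In particular $N=\tilde O(\kappa_A\sqrt{L_f}D/\sqrt\epsilon)$ for $\epsilon\le L_fD^2$, where $\tilde O$ hides logarithms (including that of $\rho$). -/

import Mathlib

noncomputable section

namespace CompositeOpt

/-- Euclidean space `ℝⁿ`. -/
abbrev Vec (n : ℕ) : Type := EuclideanSpace ℝ (Fin n)

/-- An extended-valued function is proper, closed and convex. -/
structure ProperClosedConvex {m : ℕ} (h : Vec m → EReal) : Prop where
  ne_bot : ∀ z, h z ≠ ⊥
  exists_ne_top : ∃ z, h z ≠ ⊤
  lsc : LowerSemicontinuous h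
  convex_epigraph : Convex ℝ {p : Vec m × ℝ | h p.1 ≤ (p.2 : EReal)}

/-- `f` is differentiable and its gradient is `L`-Lipschitz. -/
def IsSmooth {n : ℕ} (L : ℝ) (f : Vec n → ℝ) : Prop :=
  Differentiable ℝ f ∧ ∀ x y, ‖gradient f x - gradient f y‖ ≤ L * ‖x - y‖

/-- The conjugate function `g⋆(y) = sup_x {xᵀy - g(x)}`. -/
def conj {m : ℕ} (g : Vec m → EReal) (y : Vec m) : EReal :=
  ⨆ x : Vec m, ((inner ℝ x y : ℝ) : EReal) - g x

/-- The surrogate `h_ρ(z) = sup_{‖y‖ ≤ ρ} {zᵀy - h⋆(y)}`. -/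
def surrogate {m : ℕ} (h : Vec m → EReal) (ρ : ℝ) (z : Vec m) : EReal :=
  ⨆ y ∈ Metric.closedBall (0 : Vec m) ρ, ((inner ℝ z y : ℝ) : EReal) - conj h y

/-- The proximal operator `prox_g(x) = argmin_u {g(u) + ½‖x - u‖²}`. -/
def prox {m : ℕ} (g : Vec m → EReal) (x : Vec m) : Vec m :=
  Classical.epsilon fun u =>
    IsMinOn (fun v => g v + ((1 / 2 * ‖x - v‖ ^ 2 : ℝ) : EReal)) Set.univ u

/-- The smallest of the `min(m, n) = m` singular values of a matrix `A ∈ ℝ^{m×n}` of full row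
rank, `m ≥ 1` (the singular values are listed in decreasing order, starting with index `0`). -/
def sigmaMin {n m : ℕ} (A : Vec n →L[ℝ] Vec m) : ℝ :=
  (A : Vec n →ₗ[ℝ] Vec m).singularValues (m - 1)

/-- The condition number `κ_A = ‖A‖ / σ_min`. -/
def condNumber {n m : ℕ} (A : Vec n →L[ℝ] Vec m) : ℝ := ‖A‖ / sigmaMin A

/-- The composite objective `F(x) = f(x) + h(Ax - b)`. -/
def objective {n m : ℕ} (f : Vec n → ℝ) (h : Vec m → EReal) (A : Vec n →L[ℝ] Vec m) (b : Vec m)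
    (x : Vec n) : EReal :=
  (f x : EReal) + h (A x - b)

/-- `SubOpt_C(x) = f(x) + h_ρ(Ax - b) - min F`. -/
def subOptC {n m : ℕ} (f : Vec n → ℝ) (h : Vec m → EReal) (A : Vec n →L[ℝ] Vec m) (b : Vec m)
    (ρ : ℝ) (x : Vec n) : EReal :=
  (f x : EReal) + surrogate h ρ (A x - b) - ⨅ x' : Vec n, objective f h A b x'

/-! ### Nesterov's accelerated gradient descent -/

/-- The pair `(y_k, y_{k-1})` of accelerated gradient descent on `Ψ`, with `y_{-1} = y_0`. -/
def agdIter {n : ℕ} (Ψ : Vec n → ℝ) (L μ : ℝ) (y₀ : Vec n) : ℕ → Vec n × Vec n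
  | 0 => (y₀, y₀)
  | k + 1 =>
    let p := agdIter Ψ L μ y₀ k
    let θ : ℝ := (Real.sqrt (L / μ) - 1) / (Real.sqrt (L / μ) + 1)
    let ytilde := p.1 + θ • (p.1 - p.2)
    (ytilde - (1 / L) • gradient Ψ ytilde, p.1)

/-- The iteration counts `T ≥ 1` at which the test `‖∇Ψ(y_T)‖ ≤ μδ` of the
repeat-until loop succeeds. -/
def agdStops {n : ℕ} (Ψ : Vec n → ℝ) (L μ : ℝ) (y₀ : Vec n) (δ : ℝ) : Set ℕ :=
  {T | 1 ≤ T ∧ ‖gradient Ψ (agdIter Ψ L μ y₀ T).1‖ ≤ μ * δ}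

/-- The number of iterations performed (meaningful when `agdStops` is nonempty). -/
def agdCount {n : ℕ} (Ψ : Vec n → ℝ) (L μ : ℝ) (y₀ : Vec n) (δ : ℝ) : ℕ :=
  sInf (agdStops Ψ L μ y₀ δ)

/-- The output `AGD(Ψ, y₀, δ)`. -/
def agdOutput {n : ℕ} (Ψ : Vec n → ℝ) (L μ : ℝ) (y₀ : Vec n) (δ : ℝ) : Vec n :=
  (agdIter Ψ L μ y₀ (agdCount Ψ L μ y₀ δ)).1

/-! ### The inexact proximal point algorithm on the dual problem -/

/-- The input of the inexact proximal point algorithm for `min f(x) + h(Ax - b)`. -/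
structure PPAInput (n m : ℕ) where
  f : Vec n → ℝ
  h : Vec m → EReal
  A : Vec n →L[ℝ] Vec m
  b : Vec m
  x₀ : Vec n
  lam₀ : Vec m
  /-- smoothness parameter of `f` -/
  L : ℝ
  /-- strong convexity parameter of `f` -/
  μ : ℝ
  /-- minimal singular value of `A` -/
  σ : ℝ
  /-- regularization parameter -/
  ell : ℝ
  /-- radius parameter -/
  D : ℝ

namespace PPAInput

variable {n m : ℕ}

/-- `μ_Φ = σ_min² / L`. -/
def muPhi (I : PPAInput n m) : ℝ := I.σ ^ 2 / I.L

/-- `δ_k = (1 - μ_Φ / (12 ℓ))^{k/2} D`. -/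
def delta (I : PPAInput n m) (k : ℕ) : ℝ :=
  (1 - I.muPhi / (12 * I.ell)) ^ ((k : ℝ) / 2) * I.D

/-- `g(λ) = h⋆(λ) + (ℓ/2)‖λ - lam‖²`, where `lam` is the previous dual iterate. -/
def g (I : PPAInput n m) (lam : Vec m) (v : Vec m) : EReal :=
  conj I.h v + ((I.ell / 2 * ‖v - lam‖ ^ 2 : ℝ) : EReal)

/-- `Ψ(x) = f(x) + g⋆(Ax - b)`, where `lam` is the previous dual iterate. -/
def Psi (I : PPAInput n m) (lam : Vec m) (x : Vec n) : ℝ :=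
  I.f x + (conj (I.g lam) (I.A x - I.b)).toReal

/-- The smoothness parameter `L + ‖A‖² / ℓ` of `Ψ`. -/
def LPsi (I : PPAInput n m) : ℝ := I.L + ‖I.A‖ ^ 2 / I.ell

/-- The dual update `prox_{h⋆/ℓ}(lam + (Ax - b)/ℓ)`. -/
def dualStep (I : PPAInput n m) (lam : Vec m) (x : Vec n) : Vec m :=
  prox (fun v => ((1 / I.ell : ℝ) : EReal) * conj I.h v) (lam + (1 / I.ell) • (I.A x - I.b))

/-- The iterates `(x_k, λ_k)`:
`x_k = AGD(Ψ_k, x_{k-1}, δ_k)` and `λ_k = prox_{h⋆/ℓ}(λ_{k-1} + (A x_k - b)/ℓ)`. -/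
def iter (I : PPAInput n m) : ℕ → Vec n × Vec m
  | 0 => (I.x₀, I.lam₀)
  | k + 1 =>
    let s := iter I k
    let x := agdOutput (I.Psi s.2) I.LPsi I.μ s.1 (I.delta (k + 1))
    (x, I.dualStep s.2 x)

/-- The inner loop of outer iteration `k + 1` terminates. -/
def InnerTerminates (I : PPAInput n m) (k : ℕ) : Prop :=
  (agdStops (I.Psi (I.iter k).2) I.LPsi I.μ (I.iter k).1 (I.delta (k + 1))).Nonempty

/-- The number of inner iterations in outer iteration `k + 1`. -/
def innerCount (I : PPAInput n m) (k : ℕ) : ℕ :=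
  agdCount (I.Psi (I.iter k).2) I.LPsi I.μ (I.iter k).1 (I.delta (k + 1))

/-- The number of gradient evaluations in the first `T` outer iterations. Each inner iteration
evaluates the gradient twice: at the extrapolated point, and at the new point for the
stopping test. -/
def gradEvals (I : PPAInput n m) (T : ℕ) : ℕ :=
  ∑ k ∈ Finset.range T, 2 * I.innerCount k

end PPAInput

/-- The input for the regularized problem `min f(x) + h(Ax - b) + ε/(2D²) ‖x - x₀‖²`, whose smooth
part is `(L_f + ε/D²)`-smooth and `(ε/D²)`-strongly convex, with `ℓ = μ_Φ`. -/
def regularizedInput {n m : ℕ} (f : Vec n → ℝ) (h : Vec m → EReal) (A : Vec n →L[ℝ] Vec m)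
    (b : Vec m) (x₀ : Vec n) (lam₀ : Vec m) (Lf D ε : ℝ) : PPAInput n m where
  f := fun x => f x + ε / (2 * D ^ 2) * ‖x - x₀‖ ^ 2
  h := h
  A := A
  b := b
  x₀ := x₀
  lam₀ := lam₀
  L := Lf + ε / D ^ 2
  μ := ε / D ^ 2
  σ := sigmaMin A
  ell := sigmaMin A ^ 2 / (Lf + ε / D ^ 2)
  D := D

/-- The (dimensionless) argument of the logarithm hidden by `Õ`. -/
def logArg {n m : ℕ} (f : Vec n → ℝ) (A : Vec n →L[ℝ] Vec m) (x₀ : Vec n) (lam₀ : Vec m)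
    (Lf D ε ρ : ℝ) : ℝ :=
  2 + condNumber A + Lf * D ^ 2 / ε
    + (‖gradient f x₀‖ + ρ * ‖A‖ + ‖A‖ * ‖lam₀‖) * D / ε

end CompositeOpt

end

/-! The regularized problem has a minimizer `xe`. Comparison with `xstar` gives `‖x₀ - xe‖ ≤ D` and
shows that regularizing costs at most `ε/2` in value. Since `A` is onto, first-order optimality at
`xe` yields a multiplier `lamS` with `∇f_ε(xe) + Aᵀ lamS = 0` and `lamS ∈ ∂h(A xe - b)`.

Outer loop (`WellConditioned.step`). The bound `σ_min ‖y‖ ≤ ‖Aᵀ y‖` and cocoercivity of `∇f_ε` act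
as `σ_min²/L`-strong convexity of the dual, so a proximal step with `ℓ = σ_min²/L` contracts the
dual error by a constant factor. The stopping test makes `∇f_ε(x_k) + Aᵀ λ_k` at most `μ δ_k` in
norm. As `δ_k²` decays like `(11/12)^k`, the squared dual error decays at that rate, and so does the
squared primal error by strong convexity of `f_ε`.

Inner loop. `Ψ_k` is `μ`-strongly convex and `(L + ‖A‖²/ℓ)`-smooth, and the choice of `ℓ` makes its
condition number `(L_f D²/ε + 1)(1 + κ_A²)`. A Lyapunov function shows that accelerated descent
converges at rate `1 - 1/√κ`. The ratio of initial gradient to target is polynomial in `M`, the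
argument of the logarithm, so each call takes `O(√κ log M)` iterations; there are `O(log M)` calls.

Conclusion. `h_ρ(w) ≤ h(z) + ρ ‖w - z‖` needs only the Fenchel inequality, so the final primal
error, at most `D/(27 M)`, costs at most another `ε/2`. -/

namespace CompositeOpt

open scoped RealInnerProductSpace

/-- Cocoercivity of the gradient of a smooth convex function. -/
theorem gradient_cocoercive {E : Type*} [NormedAddCommGroup E] [InnerProductSpace ℝ E]
    {f : E → ℝ} {G : E → E} {L : ℝ} (hL : 0 < L)
    (hlo : ∀ x y, f x + ⟪G x, y - x⟫ ≤ f y)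
    (hup : ∀ x y, f y ≤ f x + ⟪G x, y - x⟫ + L / 2 * ‖y - x‖ ^ 2) (x y : E) :
    1 / L * ‖G x - G y‖ ^ 2 ≤ ⟪G x - G y, x - y⟫ := by
  have key : ∀ x y : E, f x + ⟪G x, y - x⟫ + 1 / (2 * L) * ‖G x - G y‖ ^ 2 ≤ f y := by
    intro x y
    set g := G x - G y with hg
    -- The displacement `g/L` minimizes the quadratic upper model at `y` of `f - ⟪G x, ·⟫`, a
    -- function that is itself minimal at `x`.
    have h1 := hlo x (y + (1 / L) • g)
    have h2 := hup y (y + (1 / L) • g)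
    rw [add_sub_cancel_left, norm_smul, inner_smul_right, mul_pow, Real.norm_eq_abs, sq_abs] at h2
    rw [add_sub_right_comm, inner_add_right, inner_smul_right] at h1
    have h3 : ⟪G x, g⟫ - ⟪G y, g⟫ = ‖g‖ ^ 2 := by
      rw [← inner_sub_left, ← hg, real_inner_self_eq_norm_sq]
    have h4 : L / 2 * ((1 / L) ^ 2 * ‖g‖ ^ 2) = 1 / (2 * L) * ‖g‖ ^ 2 := by field_simp
    have h5 : 1 / (2 * L) * ‖g‖ ^ 2 = 1 / L * ‖g‖ ^ 2 - 1 / (2 * L) * ‖g‖ ^ 2 := by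
      field_simp; ring
    have h6 : 1 / L * ‖g‖ ^ 2 = 1 / L * ⟪G x, g⟫ - 1 / L * ⟪G y, g⟫ := by rw [← h3]; ring
    linarith
  have h1 := key x y
  have h2 := key y x
  rw [norm_sub_rev (G y)] at h2
  have h3 : ⟪G x - G y, x - y⟫ = -⟪G x, y - x⟫ - ⟪G y, x - y⟫ := by
    rw [inner_sub_left, ← neg_sub y x, inner_neg_right, inner_neg_right]
  have h4 : 1 / L * ‖G x - G y‖ ^ 2
    = 1 / (2 * L) * ‖G x - G y‖ ^ 2 + 1 / (2 * L) * ‖G x - G y‖ ^ 2 := by field_simp; ring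
  linarith

/-! ### Smooth and strongly convex functions -/

section Smooth

variable {E : Type*} [NormedAddCommGroup E] [InnerProductSpace ℝ E] [CompleteSpace E]

/-- The derivative of a function along a line. -/
theorem hasDerivAt_line {f : E → ℝ} {G : E → E} (hf : ∀ x, HasGradientAt f (G x) x)
    (x d : E) (t : ℝ) : HasDerivAt (fun s : ℝ => f (x + s • d)) ⟪G (x + t • d), d⟫ t := by
  have h1 : HasDerivAt (fun s : ℝ => x + s • d) d t := by
    simpa using ((hasDerivAt_id t).smul_const d).const_add x
  have h2 := (hf (x + t • d)).hasFDerivAt.comp_hasDerivAt t h1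
  exact h2.congr_deriv (by simp)

/-- The descent lemma for functions with Lipschitz gradient. -/
theorem descent_lemma {f : E → ℝ} {G : E → E} {L : ℝ} (hf : ∀ x, HasGradientAt f (G x) x)
    (hG : ∀ x y, ‖G x - G y‖ ≤ L * ‖x - y‖) (x y : E) :
    f y ≤ f x + ⟪G x, y - x⟫ + L / 2 * ‖y - x‖ ^ 2 := by
  set d := y - x with hd
  let φ : ℝ → ℝ := fun t => f (x + t • d) - t * ⟪G x, d⟫ - L / 2 * t ^ 2 * ‖d‖ ^ 2
  have hφ : ∀ t, HasDerivAt φ (⟪G (x + t • d), d⟫ - ⟪G x, d⟫ - L * t * ‖d‖ ^ 2) t := by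
    intro t
    have h1 := hasDerivAt_line hf x d t
    have h2 : HasDerivAt (fun s : ℝ => s * ⟪G x, d⟫) ⟪G x, d⟫ t := by
      simpa using (hasDerivAt_id t).mul_const ⟪G x, d⟫
    have h3 : HasDerivAt (fun s : ℝ => L / 2 * s ^ 2 * ‖d‖ ^ 2) (L * t * ‖d‖ ^ 2) t := by
      have := ((hasDerivAt_pow 2 t).const_mul (L / 2)).mul_const (‖d‖ ^ 2)
      refine this.congr_deriv ?_
      push_cast
      ring
    exact (h1.sub h2).sub h3
  have hanti : AntitoneOn φ (Set.Ici 0) := by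
    refine antitoneOn_of_deriv_nonpos (convex_Ici 0)
      (fun t _ => (hφ t).continuousAt.continuousWithinAt)
      (fun t _ => (hφ t).differentiableAt.differentiableWithinAt) ?_
    intro t ht
    rw [interior_Ici, Set.mem_Ioi] at ht
    rw [(hφ t).deriv, ← inner_sub_left]
    have h1 := real_inner_le_norm (G (x + t • d) - G x) d
    have h2 := hG (x + t • d) x
    rw [add_sub_cancel_left, norm_smul, Real.norm_of_nonneg ht.le] at h2
    nlinarith [mul_le_mul_of_nonneg_right h2 (norm_nonneg d)]
  have := hanti (Set.mem_Ici.2 le_rfl) (Set.mem_Ici.2 zero_le_one) zero_le_one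
  simp only [φ, one_smul, zero_smul, add_zero] at this
  rw [hd, add_sub_cancel, ← hd] at this
  linarith

/-- The gradient inequality for convex functions. -/
theorem gradient_inequality {f : E → ℝ} {G : E → E} (hc : ConvexOn ℝ Set.univ f)
    (hf : ∀ x, HasGradientAt f (G x) x) (x y : E) : f x + ⟪G x, y - x⟫ ≤ f y := by
  have hφ : ConvexOn ℝ Set.univ (fun t : ℝ => f (x + t • (y - x))) := by
    have := hc.comp_affineMap (AffineMap.lineMap (k := ℝ) x y)
    rw [Set.preimage_univ] at this
    refine this.congr fun t _ => ?_
    simp [AffineMap.lineMap_apply, add_comm]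
  have h := hφ.le_slope_of_hasDerivAt (Set.mem_univ 0) (Set.mem_univ 1) zero_lt_one
    (hasDerivAt_line hf x (y - x) 0)
  simp [slope_def_field] at h
  linarith

/-- `Ψ` has gradient `G`, is `L`-smooth and `μ`-strongly convex. -/
structure SmoothStronglyConvex (L μ : ℝ) (Ψ : E → ℝ) (G : E → E) : Prop where
  hasGradientAt : ∀ x, HasGradientAt Ψ (G x) x
  lower : ∀ x y, Ψ x + ⟪G x, y - x⟫ + μ / 2 * ‖y - x‖ ^ 2 ≤ Ψ y
  upper : ∀ x y, Ψ y ≤ Ψ x + ⟪G x, y - x⟫ + L / 2 * ‖y - x‖ ^ 2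

namespace SmoothStronglyConvex

variable {L μ : ℝ} {Ψ : E → ℝ} {G : E → E}

theorem strongly_monotone (H : SmoothStronglyConvex L μ Ψ G) (x y : E) :
    μ * ‖x - y‖ ^ 2 ≤ ⟪G x - G y, x - y⟫ := by
  have h1 := H.lower x y
  have h2 := H.lower y x
  have h3 : ⟪G x - G y, x - y⟫ = -⟪G x, y - x⟫ - ⟪G y, x - y⟫ := by
    rw [inner_sub_left, ← neg_sub y x, inner_neg_right, inner_neg_right]
  rw [norm_sub_rev] at h1
  linarith

theorem cocoercive (H : SmoothStronglyConvex L μ Ψ G) (hL : 0 < L) (hμ : 0 ≤ μ) (x y : E) :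
    1 / L * ‖G x - G y‖ ^ 2 ≤ ⟪G x - G y, x - y⟫ :=
  gradient_cocoercive hL (fun x y => by
    have := H.lower x y
    have : 0 ≤ μ / 2 * ‖y - x‖ ^ 2 := by positivity
    linarith) H.upper x y

/-- A gradient step decreases the function. -/
theorem gradient_step (H : SmoothStronglyConvex L μ Ψ G) (hL : 0 < L) (x : E) :
    Ψ (x - (1 / L) • G x) ≤ Ψ x - 1 / (2 * L) * ‖G x‖ ^ 2 := by
  have h := H.upper x (x - (1 / L) • G x)
  rw [sub_sub_cancel_left, inner_neg_right, norm_neg, norm_smul, inner_smul_right, mul_pow,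
    Real.norm_eq_abs, sq_abs, real_inner_self_eq_norm_sq] at h
  have h4 : L / 2 * ((1 / L) ^ 2 * ‖G x‖ ^ 2)
    = 1 / L * ‖G x‖ ^ 2 - 1 / (2 * L) * ‖G x‖ ^ 2 := by field_simp; ring
  linarith

theorem exists_minimizer [FiniteDimensional ℝ E] (H : SmoothStronglyConvex L μ Ψ G)
    (hμ : 0 < μ) : ∃ y, ∀ x, Ψ y ≤ Ψ x := by
  have hcont : Continuous Ψ :=
    continuous_iff_continuousAt.2 fun x => (H.hasGradientAt x).continuousAt
  refine hcont.exists_forall_le_of_isBounded 0 ?_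
  refine (Metric.isBounded_closedBall (x := (0 : E)) (r := 2 / μ * ‖G 0‖)).subset ?_
  intro x hx
  rw [Set.mem_ofPred_eq] at hx
  rw [mem_closedBall_zero_iff]
  have h1 := H.lower 0 x
  rw [sub_zero] at h1
  have h2 := abs_le.1 (abs_real_inner_le_norm (G 0) x)
  by_contra! hlt
  have h3 : 2 * ‖G 0‖ < μ * ‖x‖ := by
    rw [div_mul_eq_mul_div, div_lt_iff₀ hμ] at hlt
    linarith
  have h4 : 0 < ‖x‖ := lt_of_le_of_lt (by positivity) hlt
  nlinarith

/-- At a point where `Ψ` is close to its minimum the gradient is small. -/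
theorem norm_gradient_sq_le (H : SmoothStronglyConvex L μ Ψ G) (hL : 0 < L) {y : E}
    (hy : ∀ x, Ψ y ≤ Ψ x) (x : E) : ‖G x‖ ^ 2 ≤ 2 * L * (Ψ x - Ψ y) := by
  have h1 := H.gradient_step hL x
  have h2 := hy (x - (1 / L) • G x)
  have h3 : 1 / (2 * L) * ‖G x‖ ^ 2 ≤ Ψ x - Ψ y := by linarith
  rwa [one_div, inv_mul_le_iff₀ (by positivity)] at h3

theorem gradient_eq_zero (H : SmoothStronglyConvex L μ Ψ G) (hL : 0 < L) {y : E}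
    (hy : ∀ x, Ψ y ≤ Ψ x) : G y = 0 := by
  have := H.norm_gradient_sq_le hL hy y
  rw [sub_self, mul_zero] at this
  have h2 : ‖G y‖ ^ 2 = 0 := le_antisymm this (by positivity)
  simpa using h2

theorem dist_minimizer_le (H : SmoothStronglyConvex L μ Ψ G) (hL : 0 < L) (hμ : 0 < μ) {y : E}
    (hy : ∀ x, Ψ y ≤ Ψ x) (x : E) : ‖x - y‖ ≤ ‖G x‖ / μ := by
  have h1 := H.strongly_monotone x y
  rw [H.gradient_eq_zero hL hy, sub_zero] at h1
  have h2 := real_inner_le_norm (G x) (x - y)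
  rw [le_div_iff₀ hμ]
  rcases (norm_nonneg (x - y)).eq_or_lt with h0 | h0
  · rw [← h0, zero_mul]; positivity
  · nlinarith

end SmoothStronglyConvex

/-- One step of the Lyapunov analysis of accelerated gradient descent, with `a = √(μ/L)`. -/
theorem SmoothStronglyConvex.lyapunov_step {L μ : ℝ} {Ψ : E → ℝ} {G : E → E}
    (H : SmoothStronglyConvex L μ Ψ G) (hL : 0 < L) (hμ : 0 < μ) {a : ℝ} (ha : 0 < a)
    (ha1 : a ≤ 1) (haL : a ^ 2 * L = μ) (z y v x : E) (hx : x - y = a • (v - x)) :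
    Ψ (x - (1 / L) • G x) - Ψ z
      + μ / 2 * ‖y + (1 / a) • (x - (1 / L) • G x - y) - z‖ ^ 2
      ≤ (1 - a) * (Ψ y - Ψ z + μ / 2 * ‖v - z‖ ^ 2) := by
  set g := G x with hg
  have h1 := H.gradient_step hL x
  have h2 := H.lower x z
  have h3 := H.lower x y
  rw [← hg] at h1 h2 h3
  have hne : a ≠ 0 := ha.ne'
  -- The new momentum point is a convex combination of `v` and `x`, moved by a gradient step of
  -- length `a/μ`. The cross term of its square then cancels the linear terms of the lower bounds at
  -- `z` and `y`, weighted by `a` and `1 - a`.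
  have hv : y + (1 / a) • (x - (1 / L) • g - y) - z
      = ((1 - a) • (v - z) + a • (x - z)) - (a / μ) • g := by
    have e1 : (1 / a) • (x - (1 / L) • g - y) = (v - x) - (a / μ) • g := by
      rw [sub_right_comm, hx, smul_sub, smul_smul, smul_smul, one_div_mul_cancel hne, one_smul]
      congr 2
      rw [← haL]; field_simp
    have e2 : y = x - a • (v - x) := by rw [← hx]; abel
    rw [e1, e2]
    module
  rw [hv, norm_sub_sq_real, inner_smul_right, norm_smul, mul_pow, Real.norm_eq_abs, sq_abs]
  set w := (1 - a) • (v - z) + a • (x - z) with hw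
  have hwn : ‖w‖ ^ 2 ≤ (1 - a) * ‖v - z‖ ^ 2 + a * ‖x - z‖ ^ 2 := by
    have hc := (convexOn_norm (convex_univ (E := E) (𝕜 := ℝ))).2 (Set.mem_univ (v - z))
      (Set.mem_univ (x - z)) (sub_nonneg.2 ha1) ha.le (sub_add_cancel 1 a)
    simp only [smul_eq_mul] at hc
    rw [← hw] at hc
    have hs := pow_le_pow_left₀ (norm_nonneg w) hc 2
    nlinarith [mul_nonneg (mul_nonneg ha.le (sub_nonneg.2 ha1)) (sq_nonneg (‖v - z‖ - ‖x - z‖))]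
  have hin : a * ⟪w, g⟫ = (1 - a) * -⟪g, y - x⟫ + a * -⟪g, z - x⟫ := by
    have e : a • w = (1 - a) • (x - y) + a • (x - z) := by rw [hw, hx]; module
    rw [← real_inner_smul_left, e, inner_add_left, real_inner_smul_left, real_inner_smul_left,
      real_inner_comm, real_inner_comm g (x - z), ← inner_neg_right, ← inner_neg_right, neg_sub,
      neg_sub]
  have hq : μ / 2 * ((a / μ) ^ 2 * ‖g‖ ^ 2) = 1 / (2 * L) * ‖g‖ ^ 2 := by
    rw [← haL]; field_simp
  have hm : μ / 2 * (2 * (a / μ * ⟪w, g⟫)) = a * ⟪w, g⟫ := by field_simp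
  have h3' : Ψ x - Ψ y ≤ -⟪g, y - x⟫ := by
    have : 0 ≤ μ / 2 * ‖y - x‖ ^ 2 := by positivity
    linarith
  rw [norm_sub_rev] at h2
  have k1 := mul_le_mul_of_nonneg_left h3' (sub_nonneg.2 ha1)
  have k2 := mul_le_mul_of_nonneg_left h2 ha.le
  have k3 := mul_le_mul_of_nonneg_left hwn (half_pos hμ).le
  have e1 : μ / 2 * (‖w‖ ^ 2 - 2 * (a / μ * ⟪w, g⟫) + (a / μ) ^ 2 * ‖g‖ ^ 2)
    = μ / 2 * ‖w‖ ^ 2 - a * ⟪w, g⟫ + 1 / (2 * L) * ‖g‖ ^ 2 := by rw [← hm, ← hq]; ring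
  rw [e1]
  nlinarith

end Smooth

/-! ### Convergence of accelerated gradient descent -/

section AGD

variable {n : ℕ} {L μ : ℝ} {Ψ : Vec n → ℝ} {G : Vec n → Vec n}

/-- Linear convergence of accelerated gradient descent. -/
theorem SmoothStronglyConvex.agdIter_bound (H : SmoothStronglyConvex L μ Ψ G) (hμ : 0 < μ)
    (hμL : μ ≤ L) (y₀ z : Vec n) (k : ℕ) :
    Ψ (agdIter Ψ L μ y₀ k).1 - Ψ z
      + μ / 2 * ‖(agdIter Ψ L μ y₀ k).1
        + (Real.sqrt (L / μ) - 1) • ((agdIter Ψ L μ y₀ k).1 - (agdIter Ψ L μ y₀ k).2) - z‖ ^ 2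
      ≤ (1 - 1 / Real.sqrt (L / μ)) ^ k * (Ψ y₀ - Ψ z + μ / 2 * ‖y₀ - z‖ ^ 2) := by
  have hL : 0 < L := hμ.trans_le hμL
  set s := Real.sqrt (L / μ) with hs
  have hs1 : 1 ≤ s := Real.one_le_sqrt.2 ((one_le_div hμ).2 hμL)
  have hs0 : 0 < s := zero_lt_one.trans_le hs1
  have hs2 : s ^ 2 = L / μ := Real.sq_sqrt (by positivity)
  have hG : gradient Ψ = G := gradient_eq H.hasGradientAt
  have ha1 : 1 / s ≤ 1 := (div_le_one hs0).2 hs1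
  induction k with
  | zero => simp [agdIter]
  | succ k ih =>
    set y := (agdIter Ψ L μ y₀ k).1 with hy
    set u := (agdIter Ψ L μ y₀ k).2 with hu
    set x := y + ((s - 1) / (s + 1)) • (y - u) with hx
    have h1 : (agdIter Ψ L μ y₀ (k + 1)).1 = x - (1 / L) • G x := by
      simp only [agdIter, hG, ← hs, ← hy, ← hu, ← hx]
    have h2 : (agdIter Ψ L μ y₀ (k + 1)).2 = y := by
      simp only [agdIter, ← hy]
    rw [h1, h2]
    -- With momentum point `v = y + (s - 1)(y - u)`, the weight `(s - 1)/(s + 1)` is exactly the one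
    -- that gives `x - y = (v - x)/s`.
    have hxy : x - y = (1 / s) • (y + (s - 1) • (y - u) - x) := by
      rw [hx, ← sub_eq_zero]
      match_scalars <;> field_simp <;> ring
    have key := H.lyapunov_step hL hμ (a := 1 / s) (by positivity) ha1
      (by rw [one_div, inv_pow, hs2]; field_simp) z y _ x hxy
    have e : x - (1 / L) • G x + (s - 1) • (x - (1 / L) • G x - y) - z
        = y + (1 / (1 / s)) • (x - (1 / L) • G x - y) - z := by
      rw [one_div_one_div]; module
    rw [e, pow_succ' (1 - 1 / s) k]
    refine key.trans ?_
    rw [mul_assoc]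
    exact mul_le_mul_of_nonneg_left ih (sub_nonneg.2 ha1)

/-- The gradient of `Ψ` along accelerated gradient descent. -/
theorem SmoothStronglyConvex.agdIter_gradient_bound (H : SmoothStronglyConvex L μ Ψ G)
    (hμ : 0 < μ) (hμL : μ ≤ L) (y₀ : Vec n) (k : ℕ) :
    ‖G (agdIter Ψ L μ y₀ k).1‖ ^ 2
      ≤ 2 * L ^ 2 * Real.exp (-(k / Real.sqrt (L / μ))) * (‖G y₀‖ / μ) ^ 2 := by
  have hL : 0 < L := hμ.trans_le hμL
  obtain ⟨z, hz⟩ := H.exists_minimizer hμ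
  have h1 := H.agdIter_bound hμ hμL y₀ z k
  have h2 := H.norm_gradient_sq_le hL hz (agdIter Ψ L μ y₀ k).1
  have h3 := H.dist_minimizer_le hL hμ hz y₀
  have h4 := H.upper z y₀
  rw [H.gradient_eq_zero hL hz, inner_zero_left, add_zero] at h4
  set s := Real.sqrt (L / μ) with hs
  have hs1 : 1 ≤ s := Real.one_le_sqrt.2 ((one_le_div hμ).2 hμL)
  have hs0 : 0 < s := zero_lt_one.trans_le hs1
  have h5 : (1 - 1 / s) ^ k ≤ Real.exp (-(k / s)) := by
    have := pow_le_pow_left₀ (sub_nonneg.2 ((div_le_one hs0).2 hs1))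
      (Real.one_sub_le_exp_neg (1 / s)) k
    rw [← Real.exp_nat_mul] at this
    rwa [mul_neg, mul_one_div] at this
  have h6 : Ψ y₀ - Ψ z + μ / 2 * ‖y₀ - z‖ ^ 2 ≤ L * (‖G y₀‖ / μ) ^ 2 := by
    have := pow_le_pow_left₀ (norm_nonneg _) h3 2
    nlinarith [sq_nonneg ‖y₀ - z‖]
  have h7 : Ψ (agdIter Ψ L μ y₀ k).1 - Ψ z
      ≤ Real.exp (-(k / s)) * (L * (‖G y₀‖ / μ) ^ 2) := by
    refine (le_add_of_nonneg_right (by positivity)).trans (h1.trans ?_)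
    refine mul_le_mul h5 h6 ?_ (Real.exp_pos _).le
    have := hz y₀
    have : 0 ≤ μ / 2 * ‖y₀ - z‖ ^ 2 := by positivity
    linarith
  calc _ ≤ _ := h2
    _ ≤ 2 * L * (Real.exp (-(k / s)) * (L * (‖G y₀‖ / μ) ^ 2)) := by gcongr
    _ = _ := by ring

/-- The stopping test of accelerated gradient descent succeeds after
`√(L/μ) log(2 (L/μ)² (‖∇Ψ(y₀)‖/μ)² / δ²)` iterations. -/
theorem SmoothStronglyConvex.mem_agdStops (H : SmoothStronglyConvex L μ Ψ G)
    (hμ : 0 < μ) (hμL : μ ≤ L) (y₀ : Vec n) {δ r : ℝ} (hδ : 0 < δ)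
    (hr : 2 * (L / μ) ^ 2 * (‖G y₀‖ / μ) ^ 2 ≤ Real.exp r * δ ^ 2) {k : ℕ} (hk1 : 1 ≤ k)
    (hk : Real.sqrt (L / μ) * r ≤ k) : k ∈ agdStops Ψ L μ y₀ δ := by
  refine ⟨hk1, ?_⟩
  have hL : 0 < L := hμ.trans_le hμL
  rw [gradient_eq H.hasGradientAt]
  refine le_of_sq_le_sq ?_ (by positivity)
  refine (H.agdIter_gradient_bound hμ hμL y₀ k).trans ?_
  have hs0 : 0 < Real.sqrt (L / μ) := Real.sqrt_pos.2 (by positivity)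
  have h1 : Real.exp (-(k / Real.sqrt (L / μ))) ≤ Real.exp (-r) := by
    refine Real.exp_le_exp.2 (neg_le_neg ?_)
    rw [le_div_iff₀ hs0]; linarith
  calc 2 * L ^ 2 * Real.exp (-(k / Real.sqrt (L / μ))) * (‖G y₀‖ / μ) ^ 2
      ≤ 2 * L ^ 2 * Real.exp (-r) * (‖G y₀‖ / μ) ^ 2 := by gcongr
    _ = μ ^ 2 * Real.exp (-r) * (2 * (L / μ) ^ 2 * (‖G y₀‖ / μ) ^ 2) := by field_simp
    _ ≤ μ ^ 2 * Real.exp (-r) * (Real.exp r * δ ^ 2) := by gcongr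
    _ = (μ * δ) ^ 2 * (Real.exp (-r) * Real.exp r) := by ring
    _ = (μ * δ) ^ 2 := by rw [← Real.exp_add]; simp

theorem SmoothStronglyConvex.agdStops_nonempty (H : SmoothStronglyConvex L μ Ψ G)
    (hμ : 0 < μ) (hμL : μ ≤ L) (y₀ : Vec n) {δ : ℝ} (hδ : 0 < δ) :
    (agdStops Ψ L μ y₀ δ).Nonempty := by
  -- For termination alone the exponent `r = c` is enough, since `c ≤ exp c`; this avoids a
  -- logarithm when `c = 0`.
  set c := 2 * (L / μ) ^ 2 * (‖G y₀‖ / μ) ^ 2 / δ ^ 2 with hc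
  refine ⟨max 1 ⌈Real.sqrt (L / μ) * c⌉₊, H.mem_agdStops hμ hμL y₀ hδ (r := c) ?_
    (le_max_left _ _) ((Nat.le_ceil _).trans (Nat.cast_le.2 (le_max_right _ _)))⟩
  have h1 : c ≤ Real.exp c := by linarith [Real.add_one_le_exp c]
  have h2 : 2 * (L / μ) ^ 2 * (‖G y₀‖ / μ) ^ 2 = c * δ ^ 2 := by
    rw [hc]; field_simp
  rw [h2]
  gcongr

end AGD

/-! ### Subgradients and minimizers of extended-valued functions -/

section ExtendedReal

variable {m : ℕ}

/-- `s` is a subgradient of the extended-valued function `H` at the point `p` of its domain. -/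
def IsSubgradient (H : Vec m → EReal) (p s : Vec m) : Prop :=
  ∃ c : ℝ, H p = c ∧ ∀ u, ((c + ⟪s, u - p⟫ : ℝ) : EReal) ≤ H u

/-- A lower semicontinuous convex function that has a subgradient somewhere. -/
structure ClosedConvexSubdifferentiable (H : Vec m → EReal) : Prop where
  lsc : LowerSemicontinuous H
  ne_bot : ∀ u, H u ≠ ⊥
  jensen : ∀ (u v : Vec m) (a b t : ℝ), H u ≤ a → H v ≤ b → 0 ≤ t → t ≤ 1 →
    H ((1 - t) • u + t • v) ≤ (((1 - t) * a + t * b : ℝ) : EReal)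
  exists_subgradient : ∃ q s, IsSubgradient H q s

theorem ProperClosedConvex.jensen {h : Vec m → EReal} (hh : ProperClosedConvex h)
    (u v : Vec m) (a b t : ℝ) (hu : h u ≤ a) (hv : h v ≤ b) (ht : 0 ≤ t) (ht1 : t ≤ 1) :
    h ((1 - t) • u + t • v) ≤ (((1 - t) * a + t * b : ℝ) : EReal) :=
  hh.convex_epigraph (x := (u, a)) hu (y := (v, b)) hv (sub_nonneg.2 ht1) ht (sub_add_cancel 1 t)

theorem IsSubgradient.monotone {H : Vec m → EReal} {p q s t : Vec m} (h₁ : IsSubgradient H p s)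
    (h₂ : IsSubgradient H q t) : 0 ≤ ⟪s - t, p - q⟫ := by
  obtain ⟨c, hc, h₁⟩ := h₁
  obtain ⟨d, hd, h₂⟩ := h₂
  have e₁ := h₁ q
  have e₂ := h₂ p
  rw [hd, EReal.coe_le_coe_iff] at e₁
  rw [hc, EReal.coe_le_coe_iff] at e₂
  rw [← neg_sub p q, inner_neg_right] at e₁
  rw [inner_sub_left]
  linarith

/-- A lower semicontinuous function with a bounded sublevel set attains its minimum. -/
theorem exists_isMinOn_of_isBounded {g : Vec m → EReal} (hg : LowerSemicontinuous g) (u₀ : Vec m)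
    (hb : Bornology.IsBounded {u | g u ≤ g u₀}) : ∃ p, IsMinOn g Set.univ p := by
  have hK : IsCompact {u | g u ≤ g u₀} :=
    Metric.isCompact_of_isClosed_isBounded (hg.isClosed_preimage (g u₀)) hb
  obtain ⟨p, hp, hmin⟩ := (hg.lowerSemicontinuousOn _).exists_isMinOn ⟨u₀, le_refl (g u₀)⟩ hK
  refine ⟨p, fun u _ => ?_⟩
  by_cases hu : g u ≤ g u₀
  · exact hmin hu
  · exact le_trans (show g p ≤ g u₀ from hp) (not_le.1 hu).le

theorem lowerSemicontinuous_add_coe {g : Vec m → EReal} (hg : LowerSemicontinuous g)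
    {φ : Vec m → ℝ} (hφ : Continuous φ) :
    LowerSemicontinuous fun u => g u + (φ u : EReal) :=
  hg.add' (continuous_coe_real_ereal.comp hφ).lowerSemicontinuous fun _ =>
    EReal.continuousAt_add (Or.inr (EReal.coe_ne_bot _)) (Or.inr (EReal.coe_ne_top _))

theorem coe_add_le_coe_iff {x : EReal} {a b : ℝ} :
    x + (a : EReal) ≤ (b : EReal) ↔ x ≤ ((b - a : ℝ) : EReal) := by
  induction x with
  | bot => simp
  | top =>
    rw [EReal.top_add_coe, top_le_iff, top_le_iff]
    exact iff_of_false (EReal.coe_ne_top _) (EReal.coe_ne_top _)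
  | coe x => rw [← EReal.coe_add, EReal.coe_le_coe_iff, EReal.coe_le_coe_iff, le_sub_iff_add_le]

theorem exists_coe_of_ne {x : EReal} (hb : x ≠ ⊥) (ht : x ≠ ⊤) : ∃ r : ℝ, x = r :=
  ⟨x.toReal, (EReal.coe_toReal ht hb).symm⟩

/-- First-order optimality for the sum of a convex extended-valued function `g` and a function
`φ` which is smooth at the minimizer. -/
theorem isMinOn_add_first_order {E : Type*} [NormedAddCommGroup E] [InnerProductSpace ℝ E]
    {g : E → EReal} {φ : E → ℝ} {p G : E} {C c : ℝ}
    (hne : ∀ u, g u ≠ ⊥)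
    (hconv : ∀ (u : E) (a t : ℝ), g u ≤ a → 0 ≤ t → t ≤ 1 →
      g (p + t • (u - p)) ≤ (((1 - t) * c + t * a : ℝ) : EReal))
    (hpc : g p = c) (hC : 0 ≤ C)
    (hφ : ∀ u, φ u ≤ φ p + ⟪G, u - p⟫ + C * ‖u - p‖ ^ 2)
    (hmin : IsMinOn (fun u => g u + (φ u : EReal)) Set.univ p) (u : E) :
    ((c - ⟪G, u - p⟫ : ℝ) : EReal) ≤ g u := by
  by_cases hu : g u = ⊤
  · rw [hu]; exact le_top
  obtain ⟨a, ha⟩ := exists_coe_of_ne (hne u) hu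
  rw [ha, EReal.coe_le_coe_iff]
  -- Minimality is tested at `p + t (u - p)` and divided by `t`; the quadratic error of `φ` then
  -- vanishes as `t → 0`.
  have key : ∀ t : ℝ, 0 < t → t ≤ 1 → c - ⟪G, u - p⟫ ≤ a + t * (C * ‖u - p‖ ^ 2) := by
    intro t ht ht1
    have h1 : g p + (φ p : EReal)
        ≤ g (p + t • (u - p)) + (φ (p + t • (u - p)) : EReal) := hmin (Set.mem_univ _)
    have h2 := h1.trans (add_le_add_left (hconv u a t ha.le ht.le ht1) _)
    rw [hpc, ← EReal.coe_add, ← EReal.coe_add, EReal.coe_le_coe_iff] at h2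
    have h3 := hφ (p + t • (u - p))
    rw [add_sub_cancel_left, inner_smul_right, norm_smul, mul_pow, Real.norm_eq_abs, sq_abs] at h3
    have h4 : t * (c - ⟪G, u - p⟫) ≤ t * (a + t * (C * ‖u - p‖ ^ 2)) := by nlinarith
    exact le_of_mul_le_mul_left h4 ht
  refine le_of_forall_pos_le_add fun e he => ?_
  set K := C * ‖u - p‖ ^ 2 with hK
  have hK0 : 0 ≤ K := by positivity
  refine (key (min 1 (e / (K + 1))) (by positivity) (min_le_left _ _)).trans ?_
  gcongr
  calc min 1 (e / (K + 1)) * K ≤ e / (K + 1) * (K + 1) := by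
        gcongr
        · exact min_le_right _ _
        · linarith
    _ = e := by field_simp

end ExtendedReal

/-! ### Convex conjugates -/

section Conjugate

variable {m : ℕ} {h : Vec m → EReal}

theorem le_conj {z y : Vec m} {r : ℝ} (hz : h z ≤ r) :
    ((⟪z, y⟫ - r : ℝ) : EReal) ≤ conj h y := by
  refine le_trans ?_ (le_iSup (fun x => ((inner ℝ x y : ℝ) : EReal) - h x) z)
  rw [EReal.coe_sub]
  exact EReal.sub_le_sub le_rfl hz

theorem conj_le (hne : ∀ z, h z ≠ ⊥) {y : Vec m} {c : ℝ}
    (H : ∀ (z : Vec m) (r : ℝ), h z = r → ⟪z, y⟫ - r ≤ c) : conj h y ≤ c := by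
  refine iSup_le fun z => ?_
  by_cases hz : h z = ⊤
  · rw [hz, EReal.sub_top]; exact bot_le
  obtain ⟨r, hr⟩ := exists_coe_of_ne (hne z) hz
  rw [hr, ← EReal.coe_sub, EReal.coe_le_coe_iff]
  exact H z r hr

theorem conj_lowerSemicontinuous (hne : ∀ z, h z ≠ ⊥) : LowerSemicontinuous (conj h) := by
  refine lowerSemicontinuous_iSup fun z => ?_
  by_cases hz : h z = ⊤
  · simp only [hz, EReal.sub_top]
    exact lowerSemicontinuous_const
  obtain ⟨r, hr⟩ := exists_coe_of_ne (hne z) hz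
  simp only [hr, ← EReal.coe_sub]
  refine (continuous_coe_real_ereal.comp ?_).lowerSemicontinuous
  fun_prop

theorem conj_ne_bot {z : Vec m} {r : ℝ} (hz : h z = r) (y : Vec m) : conj h y ≠ ⊥ :=
  ne_bot_of_le_ne_bot (EReal.coe_ne_bot _) (le_conj (y := y) hz.le)

theorem conj_jensen (hne : ∀ z, h z ≠ ⊥) (u v : Vec m) (a b t : ℝ) (hu : conj h u ≤ a)
    (hv : conj h v ≤ b) (ht : 0 ≤ t) (ht1 : t ≤ 1) :
    conj h ((1 - t) • u + t • v) ≤ (((1 - t) * a + t * b : ℝ) : EReal) := by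
  refine conj_le hne fun z r hr => ?_
  have h1 := (le_conj (y := u) hr.le).trans hu
  have h2 := (le_conj (y := v) hr.le).trans hv
  rw [EReal.coe_le_coe_iff] at h1 h2
  rw [inner_add_right, inner_smul_right, inner_smul_right]
  nlinarith [mul_le_mul_of_nonneg_left h1 (sub_nonneg.2 ht1), mul_le_mul_of_nonneg_left h2 ht]

/-- A subgradient gives equality in the Fenchel inequality, so the supremum defining the conjugate
at `y` is attained at `z`. -/
theorem IsSubgradient.conj (hne : ∀ z, h z ≠ ⊥) {z y : Vec m} (H : IsSubgradient h z y) :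
    IsSubgradient (conj h) y z := by
  obtain ⟨c, hc, H⟩ := H
  refine ⟨⟪z, y⟫ - c, le_antisymm (conj_le hne fun x r hr => ?_) (le_conj hc.le), fun u => ?_⟩
  · have := H x
    rw [hr, EReal.coe_le_coe_iff, inner_sub_right, real_inner_comm, real_inner_comm z y] at this
    linarith
  · refine le_of_eq_of_le ?_ (le_conj (y := u) hc.le)
    rw [EReal.coe_eq_coe_iff, inner_sub_right]
    ring

/-- A conjugate is a supremum of continuous affine functions, and one subgradient of `h` supplies
one of the conjugate. The Fenchel–Moreau theorem is not needed. -/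
theorem conj_closedConvexSubdifferentiable (hne : ∀ z, h z ≠ ⊥) {z y : Vec m}
    (H : IsSubgradient h z y) : ClosedConvexSubdifferentiable (conj h) where
  lsc := conj_lowerSemicontinuous hne
  ne_bot := H.elim fun _ hc => conj_ne_bot hc.1
  jensen := conj_jensen hne
  exists_subgradient := ⟨y, z, H.conj hne⟩

end Conjugate

/-! ### The proximal operator and its optimality condition -/

section Prox

variable {m : ℕ} {H : Vec m → EReal}

theorem IsSubgradient.const_mul {p s : Vec m} (hs : IsSubgradient H p s) {c : ℝ} (hc : 0 < c) :
    IsSubgradient (fun u => (c : EReal) * H u) p (c • s) := by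
  obtain ⟨r, hr, hs⟩ := hs
  refine ⟨c * r, by simp only [hr, EReal.coe_mul], fun u => ?_⟩
  rw [real_inner_smul_left, ← mul_add, EReal.coe_mul]
  exact mul_le_mul_of_nonneg_left (hs u) (EReal.coe_nonneg.2 hc.le)

theorem coe_mul_le_coe_iff {c : ℝ} (hc : 0 < c) {x : EReal} {a : ℝ} :
    (c : EReal) * x ≤ a ↔ x ≤ ((a / c : ℝ) : EReal) := by
  induction x with
  | bot => simp [EReal.coe_mul_bot_of_pos hc]
  | top => simp [EReal.coe_mul_top_of_pos hc]
  | coe x => rw [← EReal.coe_mul, EReal.coe_le_coe_iff, EReal.coe_le_coe_iff, le_div_iff₀ hc,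
      mul_comm]

theorem ClosedConvexSubdifferentiable.const_mul (hH : ClosedConvexSubdifferentiable H) {c : ℝ}
    (hc : 0 < c) : ClosedConvexSubdifferentiable (fun u => (c : EReal) * H u) where
  lsc := by
    have hcont : Continuous fun x : EReal => (c : EReal) * x :=
      continuous_iff_continuousAt.2 fun x => by
        exact (EReal.Tendsto.const_mul Filter.tendsto_id (Or.inl (EReal.coe_ne_bot _)) (Or.inl (EReal.coe_ne_top _)))
    exact hcont.comp_lowerSemicontinuous hH.lsc
      (fun x y hxy => mul_le_mul_of_nonneg_left hxy (EReal.coe_nonneg.2 hc.le))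
  ne_bot u := by
    by_cases hu : H u = ⊤
    · rw [hu, EReal.coe_mul_top_of_pos hc]; exact top_ne_bot
    · obtain ⟨r, hr⟩ := exists_coe_of_ne (hH.ne_bot u) hu
      rw [hr, ← EReal.coe_mul]; exact EReal.coe_ne_bot _
  jensen u v a b t hu hv ht ht1 := by
    rw [coe_mul_le_coe_iff hc] at hu hv ⊢
    refine (hH.jensen u v _ _ t hu hv ht ht1).trans_eq ?_
    rw [EReal.coe_eq_coe_iff]
    ring
  exists_subgradient := by
    obtain ⟨q, s, hs⟩ := hH.exists_subgradient
    exact ⟨q, c • s, hs.const_mul hc⟩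

/-- The proximal operator is well defined. -/
theorem ClosedConvexSubdifferentiable.isMinOn_prox (hH : ClosedConvexSubdifferentiable H)
    (w : Vec m) :
    IsMinOn (fun v => H v + ((1 / 2 * ‖w - v‖ ^ 2 : ℝ) : EReal)) Set.univ (prox H w) := by
  refine Classical.epsilon_spec (p := fun u =>
    IsMinOn (fun v => H v + ((1 / 2 * ‖w - v‖ ^ 2 : ℝ) : EReal)) Set.univ u) ?_
  obtain ⟨q, s, c, hc, hs⟩ := hH.exists_subgradient
  refine exists_isMinOn_of_isBounded (lowerSemicontinuous_add_coe hH.lsc (by fun_prop)) q ?_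
  -- Combining the subgradient bound at `q` with the sublevel condition gives `‖u - q‖²/2 ≤ ⟪w - q -
  -- s, u - q⟫`, hence this radius.
  refine (Metric.isBounded_closedBall (x := q)
    (r := 2 * (‖s‖ + ‖w - q‖))).subset fun u hu => ?_
  rw [Set.mem_ofPred_eq, hc, ← EReal.coe_add, coe_add_le_coe_iff] at hu
  have h1 := (hs u).trans hu
  rw [EReal.coe_le_coe_iff] at h1
  rw [mem_closedBall_iff_norm]
  have h2 := (abs_le.1 (abs_real_inner_le_norm s (u - q))).1
  have h3 : ‖w - u‖ ^ 2 = ‖w - q‖ ^ 2 - 2 * ⟪w - q, u - q⟫ + ‖u - q‖ ^ 2 := by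
    rw [← sub_sub_sub_cancel_right w u q, norm_sub_sq_real]
  have h4 := real_inner_le_norm (w - q) (u - q)
  by_contra! hlt
  have h5 : 0 < ‖u - q‖ := lt_of_le_of_lt (by positivity) hlt
  nlinarith

/-- The optimality condition of the proximal operator. -/
theorem ClosedConvexSubdifferentiable.isSubgradient_prox (hH : ClosedConvexSubdifferentiable H)
    (w : Vec m) : IsSubgradient H (prox H w) (w - prox H w) := by
  have hmin := hH.isMinOn_prox w
  set p := prox H w with hp
  obtain ⟨q, s, c, hc, -⟩ := hH.exists_subgradient
  have htop : H p ≠ ⊤ := by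
    intro htop
    have h1 := hmin (Set.mem_univ q)
    simp only [Set.mem_ofPred_eq, htop, hc, EReal.top_add_coe] at h1
    rw [← EReal.coe_add] at h1
    exact EReal.coe_ne_top _ (top_le_iff.1 h1)
  obtain ⟨a, ha⟩ := exists_coe_of_ne (hH.ne_bot p) htop
  refine ⟨a, ha, fun u => ?_⟩
  have := isMinOn_add_first_order (G := p - w) (C := 1 / 2) (c := a) hH.ne_bot
    (fun u b t hu ht ht1 => by
      have := hH.jensen p u a b t ha.le hu ht ht1
      convert this using 2
      module) ha (by norm_num) (fun u => le_of_eq (by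
        rw [← sub_sub_sub_cancel_right w u p, norm_sub_sq_real, ← neg_sub w p, inner_neg_left]
        ring)) hmin u
  rwa [← neg_sub w p, inner_neg_left, sub_neg_eq_add] at this

/-- The optimality condition of the scaled proximal operator. -/
theorem ClosedConvexSubdifferentiable.isSubgradient_prox_const_mul
    (hH : ClosedConvexSubdifferentiable H) {c : ℝ} (hc : 0 < c) (w : Vec m) :
    IsSubgradient H (prox (fun v => ((1 / c : ℝ) : EReal) * H v) w)
      (c • (w - prox (fun v => ((1 / c : ℝ) : EReal) * H v) w)) := by
  have h1 := ((hH.const_mul (one_div_pos.2 hc)).isSubgradient_prox w).const_mul hc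
  have h2 : (fun u => (c : EReal) * (((1 / c : ℝ) : EReal) * H u)) = H := by
    funext u
    rw [← mul_assoc, ← EReal.coe_mul, mul_one_div_cancel hc.ne', EReal.coe_one, one_mul]
  rwa [h2] at h1

end Prox

/-! ### The smallest singular value -/

section SingularValue

variable {n m : ℕ} {A : Vec n →L[ℝ] Vec m}

theorem finrank_range_of_surjective (hA : Function.Surjective A) :
    Module.finrank ℝ (A : Vec n →ₗ[ℝ] Vec m).range = m := by
  rw [LinearMap.range_eq_top.2 hA, finrank_top, finrank_euclideanSpace_fin]

theorem sigmaMin_pos (hm : 0 < m) (hA : Function.Surjective A) : 0 < sigmaMin A := by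
  rw [sigmaMin, LinearMap.singularValues_pos_iff_lt_finrank_range,
    finrank_range_of_surjective hA]
  omega

/-- `σ_min ‖x‖ ≤ ‖A x‖` on the orthogonal complement of the kernel. -/
theorem sigmaMin_mul_norm_le_of_mem_orthogonal (hA : Function.Surjective A) {x : Vec n}
    (hx : ∀ v, A v = 0 → ⟪x, v⟫ = 0) : sigmaMin A * ‖x‖ ≤ ‖A x‖ := by
  set T : Vec n →ₗ[ℝ] Vec m := (A : Vec n →ₗ[ℝ] Vec m) with hT
  have hn : Module.finrank ℝ (Vec n) = n := finrank_euclideanSpace_fin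
  have hS := T.isSymmetric_adjoint_comp_self
  set B := hS.eigenvectorBasis hn with hB
  have hev : ∀ i : Fin n, (LinearMap.adjoint T ∘ₗ T) (B i) = (T.singularValues i ^ 2) • B i := by
    intro i
    rw [T.sq_singularValues_fin hn i]
    exact hS.apply_eigenvectorBasis hn i
  have h1 : ‖A x‖ ^ 2 = ∑ i : Fin n, T.singularValues i ^ 2 * ⟪x, B i⟫ ^ 2 := by
    have e : ‖A x‖ ^ 2 = ⟪x, (LinearMap.adjoint T ∘ₗ T) x⟫ := by
      rw [LinearMap.comp_apply, LinearMap.adjoint_inner_right, real_inner_self_eq_norm_sq]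
      rfl
    rw [e, ← B.sum_inner_mul_inner]
    refine Finset.sum_congr rfl fun i _ => ?_
    rw [← hS (B i) x, hev, real_inner_smul_left, real_inner_comm x (B i)]
    ring
  have h2 : ‖x‖ ^ 2 = ∑ i, ⟪x, B i⟫ ^ 2 := by
    rw [← real_inner_self_eq_norm_sq, ← B.sum_inner_mul_inner]
    refine Finset.sum_congr rfl fun i _ => ?_
    rw [real_inner_comm x (B i)]
    ring
  refine le_of_sq_le_sq ?_ (norm_nonneg _)
  rw [mul_pow, h1, h2, Finset.mul_sum]
  refine Finset.sum_le_sum fun i _ => ?_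
  -- The first `m` singular values are at least `σ_min`. The others vanish because the rank is `m`;
  -- their vectors lie in the kernel, to which `x` is orthogonal.
  by_cases hi : (i : ℕ) < m
  · have := T.singularValues_antitone (show (i : ℕ) ≤ m - 1 by omega)
    have h0 := T.singularValues_nonneg (m - 1)
    rw [sigmaMin]
    gcongr
  · have h0 : T.singularValues i = 0 := by
      rw [LinearMap.singularValues_eq_zero_iff_le_finrank_range, finrank_range_of_surjective hA]
      omega
    have h3 : A (B i) = 0 := by
      have h4 := hev i
      rw [h0, zero_pow two_ne_zero, zero_smul] at h4
      have h5 : ‖A (B i)‖ ^ 2 = ⟪B i, (LinearMap.adjoint T ∘ₗ T) (B i)⟫ := by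
        rw [LinearMap.comp_apply, LinearMap.adjoint_inner_right, real_inner_self_eq_norm_sq]
        rfl
      rw [h4, inner_zero_right] at h5
      simpa using h5
    rw [hx _ h3]
    simp

/-- `σ_min ‖y‖ ≤ ‖Aᵀ y‖`. -/
theorem sigmaMin_mul_norm_le_adjoint (hm : 0 < m) (hA : Function.Surjective A) (y : Vec m) :
    sigmaMin A * ‖y‖ ≤ ‖ContinuousLinearMap.adjoint A y‖ := by
  obtain ⟨x₀, hx₀⟩ := hA y
  obtain ⟨k, hk, x, hx, hsum⟩ :=
    (LinearMap.ker (A : Vec n →ₗ[ℝ] Vec m)).exists_add_mem_mem_orthogonal x₀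
  have hk0 : A k = 0 := hk
  have hxy : A x = y := by rw [← hx₀, hsum, map_add, hk0, zero_add]
  have h1 := sigmaMin_mul_norm_le_of_mem_orthogonal hA (x := x) fun v hv =>
    ((Submodule.mem_orthogonal' _ _).1 hx v hv)
  rw [hxy] at h1
  have h2 : ‖y‖ ^ 2 = ⟪x, ContinuousLinearMap.adjoint A y⟫ := by
    rw [ContinuousLinearMap.adjoint_inner_right, hxy, real_inner_self_eq_norm_sq]
  have h3 := real_inner_le_norm x (ContinuousLinearMap.adjoint A y)
  rw [← h2] at h3
  have hs := sigmaMin_pos hm hA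
  rcases (norm_nonneg y).eq_or_lt with h0 | h0
  · rw [← h0, mul_zero]; positivity
  · refine le_of_mul_le_mul_left ?_ h0
    calc ‖y‖ * (sigmaMin A * ‖y‖) = sigmaMin A * ‖y‖ ^ 2 := by ring
      _ ≤ sigmaMin A * (‖x‖ * ‖ContinuousLinearMap.adjoint A y‖) := by gcongr
      _ = (sigmaMin A * ‖x‖) * ‖ContinuousLinearMap.adjoint A y‖ := by ring
      _ ≤ ‖y‖ * ‖ContinuousLinearMap.adjoint A y‖ := by gcongr

theorem norm_adjoint_apply_le (A : Vec n →L[ℝ] Vec m) (y : Vec m) :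
    ‖ContinuousLinearMap.adjoint A y‖ ≤ ‖A‖ * ‖y‖ := by
  have := (ContinuousLinearMap.adjoint A).le_opNorm y
  rwa [LinearIsometryEquiv.norm_map] at this

theorem one_le_condNumber (hm : 0 < m) (hA : Function.Surjective A) : 1 ≤ condNumber A := by
  have hs := sigmaMin_pos hm hA
  rw [condNumber, one_le_div hs]
  have h1 := (sigmaMin_mul_norm_le_adjoint hm hA (EuclideanSpace.single ⟨0, hm⟩ 1)).trans
    (norm_adjoint_apply_le A _)
  simpa using h1

end SingularValue

/-! ### Gradients from quadratic bounds; regularization -/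

section Gradient

variable {E : Type*} [NormedAddCommGroup E] [InnerProductSpace ℝ E] [CompleteSpace E]

theorem hasGradientAt_of_quadratic_bound {f : E → ℝ} {x g : E} {C : ℝ}
    (h : ∀ y, |f y - f x - ⟪g, y - x⟫| ≤ C * ‖y - x‖ ^ 2) : HasGradientAt f g x := by
  rw [hasGradientAt_iff_isLittleO]
  refine Asymptotics.IsBigO.trans_isLittleO (g := fun y => ‖y - x‖ ^ 2) ?_ ?_
  · refine Asymptotics.IsBigO.of_bound C (Filter.Eventually.of_forall fun y => ?_)
    rw [Real.norm_eq_abs, Real.norm_of_nonneg (by positivity)]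
    exact h y
  · have h1 : Filter.Tendsto (fun y => y - x) (nhds x) (nhds 0) := by
      have : Continuous fun y : E => y - x := by fun_prop
      simpa using this.tendsto x
    have h2 : (fun v : E => ‖v‖ ^ 2) =o[nhds 0] fun v : E => v :=
      Asymptotics.isLittleO_norm_pow_id one_lt_two
    exact h2.comp_tendsto h1

theorem HasGradientAt.add_fun {f g : E → ℝ} {u v x : E} (hf : HasGradientAt f u x)
    (hg : HasGradientAt g v x) : HasGradientAt (fun y => f y + g y) (u + v) x := by
  rw [hasGradientAt_iff_hasFDerivAt] at hf hg ⊢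
  rw [map_add]
  exact hf.add hg

/-- Adding `μ/2 ‖x - x₀‖²` to a smooth convex function. -/
theorem SmoothStronglyConvex.regularize {f : E → ℝ} {G : E → E} {L μ : ℝ}
    (hc : ConvexOn ℝ Set.univ f) (hf : ∀ x, HasGradientAt f (G x) x)
    (hG : ∀ x y, ‖G x - G y‖ ≤ L * ‖x - y‖) (x₀ : E) :
    SmoothStronglyConvex (L + μ) μ (fun x => f x + μ / 2 * ‖x - x₀‖ ^ 2)
      (fun x => G x + μ • (x - x₀)) := by
  have key : ∀ x y : E, μ / 2 * ‖y - x₀‖ ^ 2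
      = μ / 2 * ‖x - x₀‖ ^ 2 + ⟪μ • (x - x₀), y - x⟫ + μ / 2 * ‖y - x‖ ^ 2 := by
    intro x y
    rw [← sub_add_sub_cancel' x x₀ y, norm_add_sq_real, real_inner_smul_left]
    ring
  refine ⟨fun x => HasGradientAt.add_fun (hf x) (hasGradientAt_of_quadratic_bound (C := |μ / 2|) fun y => ?_),
    fun x y => ?_, fun x y => ?_⟩
  · rw [key x y, add_assoc, add_sub_cancel_left, add_sub_cancel_left, abs_mul,
      abs_of_nonneg (sq_nonneg ‖y - x‖)]
  · have := gradient_inequality hc hf x y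
    rw [inner_add_left]
    have := key x y
    nlinarith
  · have := descent_lemma hf hG x y
    rw [inner_add_left]
    have := key x y
    nlinarith

end Gradient

/-! ### Existence of a minimizer and a multiplier -/

section SaddlePoint

variable {n m : ℕ}

/-- Minimizer and multiplier of a coercive composite problem. -/
theorem exists_saddle_point {f : Vec n → ℝ} {G : Vec n → Vec n} {L μ : ℝ}
    (hf : SmoothStronglyConvex L μ f G) (hL : 0 ≤ L) {h : Vec m → EReal}
    (hh : ProperClosedConvex h) {A : Vec n →L[ℝ] Vec m} (hA : Function.Surjective A) (b : Vec m)
    {x₀ : Vec n} {B c : ℝ} (hc : 0 < c)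
    (hlow : ∀ x, ((B + c * ‖x - x₀‖ ^ 2 : ℝ) : EReal) ≤ objective f h A b x) :
    ∃ (xe : Vec n) (lam : Vec m), IsMinOn (objective f h A b) Set.univ xe ∧
      G xe + ContinuousLinearMap.adjoint A lam = 0 ∧ IsSubgradient h (A xe - b) lam := by
  have hobj : objective f h A b = fun x => h (A x - b) + (f x : EReal) := by
    funext x; rw [objective, add_comm]
  have hfc : Continuous f :=
    continuous_iff_continuousAt.2 fun x => (hf.hasGradientAt x).continuousAt
  have hlsc : LowerSemicontinuous (objective f h A b) := by
    rw [hobj]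
    exact lowerSemicontinuous_add_coe (hh.lsc.comp (by fun_prop)) hfc
  obtain ⟨z, hz⟩ := hh.exists_ne_top
  obtain ⟨r, hr⟩ := exists_coe_of_ne (hh.ne_bot z) hz
  obtain ⟨x₁, hx₁⟩ := hA (z + b)
  have hx₁' : objective f h A b x₁ = ((f x₁ + r : ℝ) : EReal) := by
    rw [objective, hx₁, add_sub_cancel_right, hr, EReal.coe_add]
  obtain ⟨xe, hxe⟩ := exists_isMinOn_of_isBounded hlsc x₁ (by
    refine (Metric.isBounded_closedBall (x := x₀)
      (r := 1 + (f x₁ + r - B) / c)).subset fun u hu => ?_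
    have h1 := (hlow u).trans hu
    rw [hx₁', EReal.coe_le_coe_iff] at h1
    rw [mem_closedBall_iff_norm]
    have h2 : ‖u - x₀‖ ^ 2 ≤ (f x₁ + r - B) / c := by
      rw [le_div_iff₀ hc]; linarith
    nlinarith [sq_nonneg (‖u - x₀‖ - 1)])
  have htop : h (A xe - b) ≠ ⊤ := by
    intro htop
    have h1 := hxe (Set.mem_univ x₁)
    rw [Set.mem_ofPred_eq, hx₁', objective, htop, EReal.coe_add_top] at h1
    exact EReal.coe_ne_top _ (top_le_iff.1 h1)
  obtain ⟨a, ha⟩ := exists_coe_of_ne (hh.ne_bot _) htop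
  have key := isMinOn_add_first_order (g := fun x => h (A x - b)) (φ := f) (p := xe) (G := G xe)
    (C := L / 2) (c := a) (fun u => hh.ne_bot _)
    (fun u d t hu ht ht1 => by
      have := hh.jensen (A xe - b) (A u - b) a d t ha.le hu ht ht1
      convert this using 2
      rw [map_add, map_smul, map_sub]
      module) ha (by positivity) (fun u => hf.upper xe u) (by rw [← hobj]; exact hxe)
  -- Moving by `±v` in the kernel leaves `h (A x - b)` unchanged, so `G xe` is orthogonal to the
  -- kernel and lies in the range of the adjoint. Surjectivity later carries the subgradient
  -- inequality to every point of `Vec m`, so no constraint qualification is needed.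
  have hker : ∀ v, A v = 0 → ⟪G xe, v⟫ = 0 := by
    intro v hv
    have h1 := key (xe + v)
    have h2 := key (xe - v)
    rw [map_add, hv, add_zero, ha, add_sub_cancel_left, EReal.coe_le_coe_iff] at h1
    rw [map_sub, hv, sub_zero, ha, sub_sub_cancel_left, inner_neg_right,
      EReal.coe_le_coe_iff] at h2
    linarith
  have hmem : G xe ∈ (LinearMap.adjoint (A : Vec n →ₗ[ℝ] Vec m)).range := by
    rw [← LinearMap.orthogonal_ker, Submodule.mem_orthogonal']
    exact fun v hv => hker v hv
  obtain ⟨y, hy⟩ := hmem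
  have hy' : ContinuousLinearMap.adjoint A y = G xe := hy
  refine ⟨xe, -y, hxe, by rw [map_neg, hy', add_neg_cancel], a, ha, fun u => ?_⟩
  obtain ⟨x, hx⟩ := hA (u + b)
  have h1 := key x
  rw [← hy', ContinuousLinearMap.adjoint_inner_left, hx, add_sub_cancel_right, map_sub, hx] at h1
  rw [inner_neg_left, ← sub_eq_add_neg]
  rwa [show u + b - A xe = u - (A xe - b) by abel] at h1

end SaddlePoint

/-! ### The dual step and the smoothness of `Ψ` -/

namespace PPAInput

variable {n m : ℕ} (I : PPAInput n m)

/-- The optimality condition of the dual step. -/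
theorem isSubgradient_dualStep (hh : ClosedConvexSubdifferentiable (conj I.h))
    (hl : 0 < I.ell) (lam : Vec m) (x : Vec n) :
    IsSubgradient (conj I.h) (I.dualStep lam x)
      (I.ell • (lam - I.dualStep lam x) + (I.A x - I.b)) := by
  have := hh.isSubgradient_prox_const_mul hl (lam + (1 / I.ell) • (I.A x - I.b))
  rw [← dualStep] at this
  convert this using 1
  rw [add_sub_right_comm, smul_add, smul_smul, mul_one_div_cancel hl.ne', one_smul]

/-- The dual step is nonexpansive in a weighted sense. -/
theorem norm_dualStep_sub_le (hl : 0 < I.ell) {p p' lam lam' z z' : Vec m}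
    {H : Vec m → EReal} (h : IsSubgradient H p (I.ell • (lam - p) + z))
    (h' : IsSubgradient H p' (I.ell • (lam' - p') + z')) :
    ‖p - p'‖ ≤ ‖lam - lam'‖ + 1 / I.ell * ‖z - z'‖ := by
  have h1 := h.monotone h'
  have e : I.ell • (lam - p) + z - (I.ell • (lam' - p') + z')
      = I.ell • (lam - lam') + (z - z') - I.ell • (p - p') := by module
  rw [e, inner_sub_left, inner_add_left, real_inner_smul_left, real_inner_smul_left,
    real_inner_self_eq_norm_sq] at h1
  have h2 := real_inner_le_norm (lam - lam') (p - p')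
  have h3 := real_inner_le_norm (z - z') (p - p')
  rcases (norm_nonneg (p - p')).eq_or_lt with h0 | h0
  · rw [← h0]; positivity
  · refine le_of_mul_le_mul_left ?_ (mul_pos hl h0)
    calc I.ell * ‖p - p'‖ * ‖p - p'‖ = I.ell * ‖p - p'‖ ^ 2 := by ring
      _ ≤ I.ell * (‖lam - lam'‖ * ‖p - p'‖) + ‖z - z'‖ * ‖p - p'‖ := by nlinarith
      _ = I.ell * ‖p - p'‖ * (‖lam - lam'‖ + 1 / I.ell * ‖z - z'‖) := by field_simp

/-- The value of the conjugate of `g`. -/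
theorem conj_g_eq (hh : ClosedConvexSubdifferentiable (conj I.h)) {lam z p : Vec m}
    (hl : 0 < I.ell) (hp : IsSubgradient (conj I.h) p (I.ell • (lam - p) + z)) :
    ∃ c : ℝ, I.g lam p = c ∧ conj (I.g lam) z = ((⟪p, z⟫ - c : ℝ) : EReal) := by
  obtain ⟨a, ha, hp⟩ := hp
  have hg : I.g lam p = ((a + I.ell / 2 * ‖p - lam‖ ^ 2 : ℝ) : EReal) := by
    rw [g, ha, EReal.coe_add]
  -- The hypothesis on `p` says that `z` is a subgradient of `g` at `p`, so `p` attains the supremum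
  -- defining the conjugate.
  refine ⟨_, hg, le_antisymm (conj_le (fun v => ?_) fun v r hr => ?_) (le_conj hg.le)⟩
  · rw [g]
    exact EReal.add_ne_bot_iff.2 ⟨hh.ne_bot v, EReal.coe_ne_bot _⟩
  · have h1 := hp v
    have h2 : conj I.h v ≤ ((r - I.ell / 2 * ‖v - lam‖ ^ 2 : ℝ) : EReal) :=
      coe_add_le_coe_iff.1 hr.le
    have h3 := h1.trans h2
    rw [EReal.coe_le_coe_iff, inner_add_left, real_inner_smul_left, inner_sub_right z] at h3
    have h4 : ‖v - lam‖ ^ 2 = ‖v - p‖ ^ 2 - 2 * ⟪lam - p, v - p⟫ + ‖p - lam‖ ^ 2 := by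
      rw [← sub_sub_sub_cancel_right v lam p, norm_sub_sq_real, norm_sub_rev lam p,
        real_inner_comm]
    rw [real_inner_comm z v, real_inner_comm z p]
    have h5 : 0 ≤ I.ell / 2 * ‖v - p‖ ^ 2 := by positivity
    rw [h4] at h3
    linarith

/-- The dual step at `x` attains the supremum there and is a competitor in the supremum at `y`. -/
theorem conj_g_subgradient (hh : ClosedConvexSubdifferentiable (conj I.h)) (hl : 0 < I.ell)
    (lam : Vec m) (x y : Vec n) :
    (conj (I.g lam) (I.A x - I.b)).toReal
      + ⟪ContinuousLinearMap.adjoint I.A (I.dualStep lam x), y - x⟫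
      ≤ (conj (I.g lam) (I.A y - I.b)).toReal := by
  obtain ⟨c, hc, hx⟩ := I.conj_g_eq hh hl (I.isSubgradient_dualStep hh hl lam x)
  obtain ⟨d, hd, hy⟩ := I.conj_g_eq hh hl (I.isSubgradient_dualStep hh hl lam y)
  have h1 := le_conj (y := I.A y - I.b) hc.le
  rw [hy, EReal.coe_le_coe_iff] at h1
  rw [hx, hy, EReal.toReal_coe, EReal.toReal_coe, ContinuousLinearMap.adjoint_inner_left]
  have e : I.A (y - x) = (I.A y - I.b) - (I.A x - I.b) := by rw [map_sub]; abel
  rw [e, inner_sub_right (I.dualStep lam x) (I.A y - I.b)]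
  linarith

/-- The gradient of `Ψ`. -/
noncomputable def gradPsi (G : Vec n → Vec n) (lam : Vec m) (x : Vec n) : Vec n :=
  G x + ContinuousLinearMap.adjoint I.A (I.dualStep lam x)

theorem norm_adjoint_dualStep_sub_le (hh : ClosedConvexSubdifferentiable (conj I.h))
    (hl : 0 < I.ell) (lam : Vec m) (x y : Vec n) :
    ‖ContinuousLinearMap.adjoint I.A (I.dualStep lam x)
      - ContinuousLinearMap.adjoint I.A (I.dualStep lam y)‖
      ≤ ‖I.A‖ ^ 2 / I.ell * ‖x - y‖ := by
  rw [← map_sub]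
  refine (norm_adjoint_apply_le _ _).trans ?_
  have h1 := I.norm_dualStep_sub_le hl (I.isSubgradient_dualStep hh hl lam x)
    (I.isSubgradient_dualStep hh hl lam y)
  rw [sub_self, norm_zero, zero_add, sub_sub_sub_cancel_right, ← map_sub] at h1
  have h2 := I.A.le_opNorm (x - y)
  calc ‖I.A‖ * ‖I.dualStep lam x - I.dualStep lam y‖
      ≤ ‖I.A‖ * (1 / I.ell * (‖I.A‖ * ‖x - y‖)) := by
        gcongr
        exact h1.trans (by gcongr)
    _ = ‖I.A‖ ^ 2 / I.ell * ‖x - y‖ := by ring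

/-- The subgradient inequalities at `x` and at `y` place the first-order remainder of the conjugate
term between `0` and `⟪Aᵀ(p_y - p_x), y - x⟫`, where `p` is the dual step. As `p` is Lipschitz, this
is at most `‖A‖²/ℓ ‖y - x‖²`, which gives differentiability. Strong convexity comes from `f` alone.
-/
theorem Psi_smoothStronglyConvex {G : Vec n → Vec n}
    (hf : SmoothStronglyConvex I.L I.μ I.f G)
    (hG : ∀ x y, ‖G x - G y‖ ≤ I.L * ‖x - y‖)
    (hh : ClosedConvexSubdifferentiable (conj I.h)) (hl : 0 < I.ell) (lam : Vec m) :
    SmoothStronglyConvex I.LPsi I.μ (I.Psi lam) (I.gradPsi G lam) := by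
  have hgrad : ∀ x, HasGradientAt (I.Psi lam) (I.gradPsi G lam x) x := by
    intro x
    refine HasGradientAt.add_fun (hf.hasGradientAt x)
      (hasGradientAt_of_quadratic_bound (C := ‖I.A‖ ^ 2 / I.ell) fun y => ?_)
    have h1 := I.conj_g_subgradient hh hl lam x y
    have h2 := I.conj_g_subgradient hh hl lam y x
    rw [abs_of_nonneg (by linarith)]
    rw [← neg_sub y x, inner_neg_right] at h2
    have h3 := real_inner_le_norm (ContinuousLinearMap.adjoint I.A (I.dualStep lam y)
      - ContinuousLinearMap.adjoint I.A (I.dualStep lam x)) (y - x)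
    rw [inner_sub_left] at h3
    have h4 := mul_le_mul_of_nonneg_right (I.norm_adjoint_dualStep_sub_le hh hl lam y x)
      (norm_nonneg (y - x))
    nlinarith
  refine ⟨hgrad, fun x y => ?_, descent_lemma hgrad fun x y => ?_⟩
  · have h1 := I.conj_g_subgradient hh hl lam x y
    have h2 := hf.lower x y
    rw [gradPsi, inner_add_left, Psi, Psi]
    linarith
  · rw [gradPsi, gradPsi, add_sub_add_comm, LPsi, add_mul]
    exact (norm_add_le _ _).trans
      (add_le_add (hG x y) (I.norm_adjoint_dualStep_sub_le hh hl lam x y))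

end PPAInput

/-! ### Outer convergence and iteration counts -/

namespace PPAInput

variable {n m : ℕ}

/-- The data of a smooth strongly convex problem with saddle point `(xe, lamS)`, whose condition
numbers and initial errors are bounded in terms of `M`. -/
structure WellConditioned (I : PPAInput n m) (G : Vec n → Vec n) (xe : Vec n) (lamS : Vec m)
    (M : ℝ) : Prop where
  smooth : SmoothStronglyConvex I.L I.μ I.f G
  lipschitz : ∀ x y, ‖G x - G y‖ ≤ I.L * ‖x - y‖
  conj : ClosedConvexSubdifferentiable (conj I.h)
  mu_pos : 0 < I.μ
  mu_le : I.μ ≤ I.L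
  sigma_pos : 0 < I.σ
  sigma_le : ∀ y, I.σ * ‖y‖ ≤ ‖ContinuousLinearMap.adjoint I.A y‖
  ell_eq : I.ell = I.σ ^ 2 / I.L
  D_pos : 0 < I.D
  stationary : G xe + ContinuousLinearMap.adjoint I.A lamS = 0
  subgradient : IsSubgradient (CompositeOpt.conj I.h) lamS (I.A xe - I.b)
  three_le : 3 ≤ M
  ratio_le : I.L / I.μ ≤ M
  cond_le : ‖I.A‖ / I.σ ≤ M
  sqrt_ratio_le : Real.sqrt (I.LPsi / I.μ) ^ 2 ≤ M ^ 3
  primal_le : ‖I.x₀ - xe‖ ≤ I.D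
  dual_le : I.σ * ‖I.lam₀ - lamS‖ ≤ M * I.μ * I.D

namespace WellConditioned

variable {I : PPAInput n m} {G : Vec n → Vec n} {xe : Vec n} {lamS : Vec m} {M : ℝ}

theorem L_pos (W : I.WellConditioned G xe lamS M) : 0 < I.L := W.mu_pos.trans_le W.mu_le

theorem ell_pos (W : I.WellConditioned G xe lamS M) : 0 < I.ell := by
  have := W.L_pos
  have := W.sigma_pos
  rw [W.ell_eq]
  positivity

theorem mu_le_LPsi (W : I.WellConditioned G xe lamS M) : I.μ ≤ I.LPsi := by
  have := W.ell_pos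
  have h : 0 ≤ ‖I.A‖ ^ 2 / I.ell := by positivity
  rw [LPsi]
  linarith [W.mu_le]

theorem M_pos (W : I.WellConditioned G xe lamS M) : 0 < M := by linarith [W.three_le]

theorem Psi_smooth (W : I.WellConditioned G xe lamS M) (lam : Vec m) :
    SmoothStronglyConvex I.LPsi I.μ (I.Psi lam) (I.gradPsi G lam) :=
  I.Psi_smoothStronglyConvex W.smooth W.lipschitz W.conj W.ell_pos lam

theorem delta_eq (W : I.WellConditioned G xe lamS M) (k : ℕ) :
    I.delta k = (11 / 12 : ℝ) ^ ((k : ℝ) / 2) * I.D := by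
  have h : I.muPhi / (12 * I.ell) = 1 / 12 := by
    rw [muPhi, ← W.ell_eq]
    have := W.ell_pos.ne'
    field_simp
  rw [delta, h]
  norm_num

theorem delta_pos (W : I.WellConditioned G xe lamS M) (k : ℕ) : 0 < I.delta k := by
  rw [W.delta_eq]
  have := W.D_pos
  positivity

theorem delta_sq (W : I.WellConditioned G xe lamS M) (k : ℕ) :
    I.delta k ^ 2 = (11 / 12 : ℝ) ^ k * I.D ^ 2 := by
  rw [W.delta_eq, mul_pow, ← Real.rpow_natCast (_ ^ _), ← Real.rpow_mul (by norm_num),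
    ← Real.rpow_natCast]
  norm_num

theorem innerTerminates (W : I.WellConditioned G xe lamS M) (k : ℕ) : I.InnerTerminates k :=
  (W.Psi_smooth _).agdStops_nonempty W.mu_pos W.mu_le_LPsi _ (W.delta_pos _)

theorem norm_gradPsi_iter_le (W : I.WellConditioned G xe lamS M) (k : ℕ) :
    ‖G (I.iter (k + 1)).1 + ContinuousLinearMap.adjoint I.A (I.iter (k + 1)).2‖
      ≤ I.μ * I.delta (k + 1) := by
  have h := (Nat.sInf_mem (W.innerTerminates k)).2
  rw [gradient_eq (W.Psi_smooth _).hasGradientAt] at h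
  exact h

/-- One step of the inexact proximal point algorithm with gradient error at most `μδ`. -/
theorem step (W : I.WellConditioned G xe lamS M) {x : Vec n} {lam : Vec m} {δ : ℝ}
    (he : ‖G x + ContinuousLinearMap.adjoint I.A (I.dualStep lam x)‖ ≤ I.μ * δ) :
    3 / 2 * ‖I.dualStep lam x - lamS‖ ^ 2
        ≤ ‖lam - lamS‖ ^ 2 + 2 * (I.μ / I.ell) * δ ^ 2 ∧
      ‖x - xe‖ ^ 2 ≤ δ ^ 2 + I.ell / I.μ * ‖lam - lamS‖ ^ 2 := by
  have hL := W.L_pos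
  have hμ := W.mu_pos
  have hl := W.ell_pos
  set p := I.dualStep lam x with hp
  set e := G x + ContinuousLinearMap.adjoint I.A p with he'
  have hmono := (I.isSubgradient_dualStep W.conj hl lam x).monotone W.subgradient
  rw [← hp] at hmono
  have e1 : I.ell • (lam - p) + (I.A x - I.b) - (I.A xe - I.b)
      = I.ell • ((lam - lamS) - (p - lamS)) + I.A (x - xe) := by rw [map_sub]; module
  rw [e1, inner_add_left, real_inner_smul_left, inner_sub_left, real_inner_self_eq_norm_sq] at hmono
  have e2 : G x - G xe = e - ContinuousLinearMap.adjoint I.A (p - lamS) := by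
    rw [he', map_sub, eq_neg_of_add_eq_zero_left W.stationary]; abel
  have e3 : ⟪I.A (x - xe), p - lamS⟫ = ⟪e, x - xe⟫ - ⟪G x - G xe, x - xe⟫ := by
    rw [e2, inner_sub_left, ContinuousLinearMap.adjoint_inner_left, real_inner_comm]; ring
  have h1 := W.smooth.strongly_monotone x xe
  have h2 := W.smooth.cocoercive hL hμ.le x xe
  set X := ⟪G x - G xe, x - xe⟫ with hX
  set a := ‖lam - lamS‖ with ha
  set d := ‖p - lamS‖ with hd
  set r := ‖x - xe‖ with hr
  have hes : ‖e‖ ^ 2 ≤ I.μ ^ 2 * δ ^ 2 := by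
    rw [← mul_pow]; exact pow_le_pow_left₀ (norm_nonneg _) he 2
  have h3 : ⟪lam - lamS, p - lamS⟫ ≤ (a ^ 2 + d ^ 2) / 2 := by
    have := real_inner_le_norm (lam - lamS) (p - lamS)
    nlinarith [sq_nonneg (a - d)]
  have h4 : ⟪e, x - xe⟫ ≤ I.μ / 2 * r ^ 2 + I.μ / 2 * δ ^ 2 := by
    have h5 := (real_inner_le_norm e (x - xe)).trans (mul_le_mul_of_nonneg_right he (norm_nonneg _))
    rw [← hr] at h5
    nlinarith [mul_nonneg hμ.le (sq_nonneg (δ - r))]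
  -- Monotonicity of the subdifferential of the conjugate bounds `X` above. Strong monotonicity, `μ
  -- r² ≤ X`, absorbs the `r²` term; for the dual estimate, cocoercivity bounds the remaining `X/2`
  -- below by a multiple of `d²`.
  have h5 : X ≤ I.μ / 2 * r ^ 2 + I.μ / 2 * δ ^ 2 + I.ell / 2 * (a ^ 2 - d ^ 2) := by
    have := mul_le_mul_of_nonneg_left h3 hl.le
    rw [e3] at hmono
    linarith
  constructor
  · have h6 : (I.σ * d) ^ 2 / 2 - I.μ ^ 2 * δ ^ 2 ≤ ‖G x - G xe‖ ^ 2 := by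
      have h7 := W.sigma_le (p - lamS)
      have h8 : ‖ContinuousLinearMap.adjoint I.A (p - lamS)‖ ≤ ‖e‖ + ‖G x - G xe‖ := by
        rw [show ContinuousLinearMap.adjoint I.A (p - lamS) = e - (G x - G xe) by rw [e2]; abel]
        exact norm_sub_le _ _
      have h9 := pow_le_pow_left₀ (mul_nonneg W.sigma_pos.le (norm_nonneg _)) (h7.trans h8) 2
      nlinarith [sq_nonneg (‖e‖ - ‖G x - G xe‖)]
    have h7 : 1 / I.L * ((I.σ * d) ^ 2 / 2 - I.μ ^ 2 * δ ^ 2) ≤ X :=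
      (mul_le_mul_of_nonneg_left h6 (by positivity)).trans h2
    have h8 : 1 / I.L * ((I.σ * d) ^ 2 / 2 - I.μ ^ 2 * δ ^ 2)
        = I.ell / 2 * d ^ 2 - I.μ / I.L * (I.μ * δ ^ 2) := by
      rw [W.ell_eq]; ring
    have h9 : I.μ / I.L * (I.μ * δ ^ 2) ≤ 1 * (I.μ * δ ^ 2) := by
      gcongr
      exact (div_le_one hL).2 W.mu_le
    have h10 : 3 / 2 * d ^ 2 * I.ell ≤ a ^ 2 * I.ell + 2 * I.μ * δ ^ 2 := by linarith
    rw [show a ^ 2 + 2 * (I.μ / I.ell) * δ ^ 2 = (a ^ 2 * I.ell + 2 * I.μ * δ ^ 2) / I.ell by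
      field_simp, le_div_iff₀ hl]
    exact h10
  · have h6 : r ^ 2 * I.μ ≤ δ ^ 2 * I.μ + I.ell * a ^ 2 := by
      have : 0 ≤ I.ell / 2 * d ^ 2 := by positivity
      linarith
    rw [show δ ^ 2 + I.ell / I.μ * a ^ 2 = (δ ^ 2 * I.μ + I.ell * a ^ 2) / I.μ by field_simp,
      le_div_iff₀ hμ]
    exact h6

/-- Linear convergence of the dual iterates. -/
theorem dual_error_le (W : I.WellConditioned G xe lamS M) (k : ℕ) :
    ‖(I.iter k).2 - lamS‖ ^ 2
      ≤ (11 / 12) ^ k * (‖I.lam₀ - lamS‖ ^ 2 + 5 * (I.μ / I.ell * I.D ^ 2)) := by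
  have hl := W.ell_pos
  have hμ := W.mu_pos
  have hc : 0 ≤ I.μ / I.ell * I.D ^ 2 := by positivity
  induction k with
  | zero =>
    rw [pow_zero, one_mul]
    simp only [iter]
    linarith
  | succ k ih =>
    have h := (W.step (W.norm_gradPsi_iter_le k)).1
    rw [W.delta_sq] at h
    change 3 / 2 * ‖(I.iter (k + 1)).2 - lamS‖ ^ 2 ≤ _ at h
    set E := ‖(I.iter (k + 1)).2 - lamS‖ ^ 2
    -- The constant `5` closes the induction: `5 + 11/6 ≤ (3/2)(11/12) · 5`.
    set c := I.μ / I.ell * I.D ^ 2 with hcd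
    have hq : (0 : ℝ) < (11 / 12) ^ k := by positivity
    have e : 2 * (I.μ / I.ell) * ((11 / 12) ^ (k + 1) * I.D ^ 2)
        = (11 / 12) ^ k * (11 / 6 * c) := by rw [hcd, pow_succ]; ring
    rw [e] at h
    rw [pow_succ]
    have hE0 : 0 ≤ (11 / 12 : ℝ) ^ k * ‖I.lam₀ - lamS‖ ^ 2 := by positivity
    have hqc : 0 ≤ (11 / 12 : ℝ) ^ k * c := by positivity
    linarith

/-- The factor `ℓ/μ = σ²/(L μ)` turns the squared dual error into a squared primal length, so
`dual_le` bounds the initial value by `M² D²`. -/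
theorem scaled_dual_error_le (W : I.WellConditioned G xe lamS M) (k : ℕ) :
    I.ell / I.μ * ‖(I.iter k).2 - lamS‖ ^ 2 ≤ (11 / 12) ^ k * ((M ^ 2 + 5) * I.D ^ 2) := by
  have hl := W.ell_pos
  have hμ := W.mu_pos
  have hL := W.L_pos
  have h1 := mul_le_mul_of_nonneg_left (W.dual_error_le k) (div_pos hl hμ).le
  refine h1.trans ?_
  rw [mul_left_comm]
  refine mul_le_mul_of_nonneg_left ?_ (by positivity)
  have h2 := pow_le_pow_left₀ (mul_nonneg W.sigma_pos.le (norm_nonneg _)) W.dual_le 2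
  have h3 : I.ell / I.μ * ‖I.lam₀ - lamS‖ ^ 2 ≤ M ^ 2 * I.D ^ 2 := by
    calc I.ell / I.μ * ‖I.lam₀ - lamS‖ ^ 2
        = (I.σ * ‖I.lam₀ - lamS‖) ^ 2 / (I.L * I.μ) := by rw [W.ell_eq]; field_simp
      _ ≤ (M * I.μ * I.D) ^ 2 / (I.μ * I.μ) := by
          gcongr
          exact W.mu_le
      _ = M ^ 2 * I.D ^ 2 := by field_simp
  have h4 : I.ell / I.μ * (5 * (I.μ / I.ell * I.D ^ 2)) = 5 * I.D ^ 2 := by field_simp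
  rw [mul_add, h4]
  linarith

/-- Linear convergence of the primal iterates. -/
theorem primal_error_le (W : I.WellConditioned G xe lamS M) (k : ℕ) :
    ‖(I.iter (k + 1)).1 - xe‖ ^ 2 ≤ (11 / 12) ^ k * ((M ^ 2 + 6) * I.D ^ 2) := by
  have h := (W.step (W.norm_gradPsi_iter_le k)).2
  rw [W.delta_sq] at h
  change ‖(I.iter (k + 1)).1 - xe‖ ^ 2 ≤ _ at h
  have h2 := W.scaled_dual_error_le k
  have h3 : 0 ≤ (11 / 12 : ℝ) ^ k * I.D ^ 2 := by positivity
  rw [pow_succ (11 / 12 : ℝ) k] at h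
  linarith

theorem primal_error_le_const (W : I.WellConditioned G xe lamS M) (k : ℕ) :
    ‖(I.iter k).1 - xe‖ ≤ 2 * M * I.D := by
  have hD := W.D_pos
  have hM := W.three_le
  cases k with
  | zero =>
    refine (show ‖(I.iter 0).1 - xe‖ ≤ I.D from W.primal_le).trans ?_
    nlinarith
  | succ k =>
    refine le_of_sq_le_sq ?_ (by positivity)
    calc _ ≤ _ := W.primal_error_le k
      _ ≤ 1 * ((M ^ 2 + 6) * I.D ^ 2) := by
        gcongr
        exact pow_le_one₀ (by norm_num) (by norm_num)
      _ ≤ 1 * ((2 * M) ^ 2 * I.D ^ 2) := by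
        gcongr
        nlinarith
      _ = _ := by ring

/-- The pair `(xe, lamS)` is fixed by the dual step and makes the gradient vanish, so the gradient
is bounded by distances to that pair. -/
theorem norm_gradPsi_le (W : I.WellConditioned G xe lamS M) (lam : Vec m) (x : Vec n) :
    ‖I.gradPsi G lam x‖ ≤ I.LPsi * ‖x - xe‖ + ‖I.A‖ * ‖lam - lamS‖ := by
  have hl := W.ell_pos
  have h1 := I.norm_dualStep_sub_le (lam' := lamS) (z' := I.A xe - I.b) hl
    (I.isSubgradient_dualStep W.conj hl lam x)
    (by rw [sub_self, smul_zero, zero_add]; exact W.subgradient)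
  rw [sub_sub_sub_cancel_right, ← map_sub] at h1
  have h2 := I.A.le_opNorm (x - xe)
  have e : I.gradPsi G lam x
      = (G x - G xe) + ContinuousLinearMap.adjoint I.A (I.dualStep lam x - lamS) := by
    rw [gradPsi, map_sub, eq_neg_of_add_eq_zero_left W.stationary]; abel
  rw [e]
  calc _ ≤ _ := norm_add_le _ _
    _ ≤ I.L * ‖x - xe‖ + ‖I.A‖ * ‖I.dualStep lam x - lamS‖ :=
      add_le_add (W.lipschitz x xe) (norm_adjoint_apply_le _ _)
    _ ≤ I.L * ‖x - xe‖ + ‖I.A‖ * (‖lam - lamS‖ + 1 / I.ell * (‖I.A‖ * ‖x - xe‖)) := by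
      gcongr
      exact h1.trans (by gcongr)
    _ = _ := by rw [LPsi]; ring

theorem norm_gradPsi_iter_start_le (W : I.WellConditioned G xe lamS M) (k : ℕ) :
    ‖I.gradPsi G (I.iter k).2 (I.iter k).1‖ / I.μ ≤ 4 * M ^ 4 * I.D := by
  have hl := W.ell_pos
  have hμ := W.mu_pos
  have hL := W.L_pos
  have hM := W.three_le
  have hD := W.D_pos
  have hσ := W.sigma_pos
  have h1 := W.norm_gradPsi_le (I.iter k).2 (I.iter k).1
  have hκ : I.LPsi / I.μ ≤ M ^ 3 := by
    have := W.sqrt_ratio_le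
    rwa [Real.sq_sqrt (div_pos (hμ.trans_le W.mu_le_LPsi) hμ).le] at this
  have h2 : ‖I.A‖ * ‖(I.iter k).2 - lamS‖ / I.μ ≤ 2 * M ^ 3 * I.D := by
    refine le_of_sq_le_sq ?_ (by positivity)
    calc (‖I.A‖ * ‖(I.iter k).2 - lamS‖ / I.μ) ^ 2
        = (‖I.A‖ / I.σ) ^ 2 * (I.L / I.μ) * (I.ell / I.μ * ‖(I.iter k).2 - lamS‖ ^ 2) := by
          rw [W.ell_eq]; field_simp
      _ ≤ M ^ 2 * M * ((11 / 12) ^ k * ((M ^ 2 + 5) * I.D ^ 2)) := by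
          refine mul_le_mul ?_ (W.scaled_dual_error_le k) (by positivity) (by positivity)
          gcongr
          · exact W.cond_le
          · exact W.ratio_le
      _ ≤ M ^ 2 * M * (1 * ((M ^ 2 + 5) * I.D ^ 2)) := by
          gcongr
          exact pow_le_one₀ (by norm_num) (by norm_num)
      _ ≤ M ^ 2 * M * (1 * ((4 * M ^ 3) * I.D ^ 2)) := by
          gcongr
          nlinarith [sq_nonneg M]
      _ = (2 * M ^ 3 * I.D) ^ 2 := by ring
  calc ‖I.gradPsi G (I.iter k).2 (I.iter k).1‖ / I.μ
      ≤ (I.LPsi * ‖(I.iter k).1 - xe‖ + ‖I.A‖ * ‖(I.iter k).2 - lamS‖) / I.μ := by gcongr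
    _ = I.LPsi / I.μ * ‖(I.iter k).1 - xe‖ + ‖I.A‖ * ‖(I.iter k).2 - lamS‖ / I.μ := by ring
    _ ≤ M ^ 3 * (2 * M * I.D) + 2 * M ^ 3 * I.D :=
      add_le_add (mul_le_mul hκ (W.primal_error_le_const k) (norm_nonneg _) (by positivity)) h2
    _ = 2 * M ^ 4 * I.D + 2 * M ^ 3 * I.D * 1 := by ring
    _ ≤ 2 * M ^ 4 * I.D + 2 * M ^ 3 * I.D * M := by
      gcongr
      linarith
    _ = 4 * M ^ 4 * I.D := by ring

theorem one_le_log (W : I.WellConditioned G xe lamS M) : 1 ≤ Real.log M := by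
  rw [Real.le_log_iff_exp_le W.M_pos]
  linarith [Real.exp_one_lt_three, W.three_le]

/-- The number of inner iterations in each outer iteration. -/
theorem innerCount_le (W : I.WellConditioned G xe lamS M) {k : ℕ}
    (hk : k < ⌈132 * Real.log M⌉₊) :
    (I.innerCount k : ℝ) ≤ 32 * Real.sqrt (I.LPsi / I.μ) * Real.log M := by
  have hμ := W.mu_pos
  have hM := W.M_pos
  have hlog := W.one_le_log
  have hD := W.D_pos
  set s := Real.sqrt (I.LPsi / I.μ) with hs
  have hs1 : 1 ≤ s := Real.one_le_sqrt.2 ((one_le_div hμ).2 W.mu_le_LPsi)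
  have hκ : I.LPsi / I.μ ≤ M ^ 3 := by
    have := W.sqrt_ratio_le
    rwa [Real.sq_sqrt (div_pos (hμ.trans_le W.mu_le_LPsi) hμ).le] at this
  have hk1 : ((k + 1 : ℕ) : ℝ) ≤ 132 * Real.log M + 1 :=
    (Nat.cast_le.2 (Nat.succ_le_of_lt hk)).trans (Nat.ceil_lt_add_one (by linarith)).le
  -- The tolerance is not too small: `(132 log M + 1)/11 ≤ 13 log M`, because `log M ≥ 1`.
  have hq : Real.exp (-(13 * Real.log M)) ≤ (11 / 12 : ℝ) ^ (k + 1) := by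
    have h1 : Real.exp (-(1 / 11)) ≤ (11 / 12 : ℝ) := by
      rw [Real.exp_neg, inv_le_comm₀ (Real.exp_pos _) (by norm_num)]
      have := Real.add_one_le_exp (1 / 11 : ℝ)
      norm_num at this ⊢
      linarith
    calc Real.exp (-(13 * Real.log M)) ≤ Real.exp (((k + 1 : ℕ) : ℝ) * -(1 / 11)) := by
          refine Real.exp_le_exp.2 ?_
          linarith
      _ = Real.exp (-(1 / 11)) ^ (k + 1) := Real.exp_nat_mul _ _
      _ ≤ _ := pow_le_pow_left₀ (Real.exp_pos _).le h1 _
  have hexp : M ^ 18 * Real.exp (13 * Real.log M) = Real.exp (31 * Real.log M) := by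
    nth_rewrite 1 [← Real.exp_log hM]
    rw [← Real.exp_nat_mul, ← Real.exp_add]
    congr 1
    push_cast
    ring
  -- Here `31 = 18 + 13`: the condition number squared gives `M^6`, the initial gradient squared
  -- gives `M^8`, the factor `32` is at most `M^4`, and the tolerance costs `M^13`.
  have hr : 2 * (I.LPsi / I.μ) ^ 2
      * (‖I.gradPsi G (I.iter k).2 (I.iter k).1‖ / I.μ) ^ 2
      ≤ Real.exp (31 * Real.log M) * I.delta (k + 1) ^ 2 := by
    have h0 : 0 ≤ I.LPsi / I.μ := (div_pos (hμ.trans_le W.mu_le_LPsi) hμ).le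
    calc _ ≤ 2 * (M ^ 3) ^ 2 * (4 * M ^ 4 * I.D) ^ 2 := by
          gcongr
          exact W.norm_gradPsi_iter_start_le k
      _ = M ^ 14 * I.D ^ 2 * 32 := by ring
      _ ≤ M ^ 14 * I.D ^ 2 * M ^ 4 := by
          gcongr
          calc (32 : ℝ) ≤ 3 ^ 4 := by norm_num
            _ ≤ M ^ 4 := pow_le_pow_left₀ (by norm_num) W.three_le 4
      _ = M ^ 18 * I.D ^ 2 * (Real.exp (13 * Real.log M) * Real.exp (-(13 * Real.log M))) := by
          rw [← Real.exp_add, add_neg_cancel, Real.exp_zero]; ring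
      _ = M ^ 18 * Real.exp (13 * Real.log M) * (Real.exp (-(13 * Real.log M)) * I.D ^ 2) := by
          ring
      _ ≤ Real.exp (31 * Real.log M) * ((11 / 12 : ℝ) ^ (k + 1) * I.D ^ 2) := by
          rw [hexp]
          gcongr
      _ = _ := by rw [W.delta_sq]
  have hpos : 0 < s * (31 * Real.log M) := by positivity
  have hmem := (W.Psi_smooth (I.iter k).2).mem_agdStops hμ W.mu_le_LPsi (I.iter k).1
    (W.delta_pos (k + 1)) hr (k := ⌈s * (31 * Real.log M)⌉₊) (Nat.ceil_pos.2 hpos)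
    (Nat.le_ceil _)
  have h1 : I.innerCount k ≤ ⌈s * (31 * Real.log M)⌉₊ := Nat.sInf_le hmem
  calc (I.innerCount k : ℝ) ≤ (⌈s * (31 * Real.log M)⌉₊ : ℝ) := Nat.cast_le.2 h1
    _ ≤ s * (31 * Real.log M) + 1 := (Nat.ceil_lt_add_one hpos.le).le
    _ ≤ _ := by nlinarith

theorem gradEvals_le (W : I.WellConditioned G xe lamS M) :
    (I.gradEvals ⌈132 * Real.log M⌉₊ : ℝ)
      ≤ 8512 * Real.sqrt (I.LPsi / I.μ) * Real.log M ^ 2 := by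
  have hlog := W.one_le_log
  rw [gradEvals, Nat.cast_sum]
  calc _ ≤ ∑ k ∈ Finset.range ⌈132 * Real.log M⌉₊,
        64 * Real.sqrt (I.LPsi / I.μ) * Real.log M := by
        refine Finset.sum_le_sum fun k hk => ?_
        have := W.innerCount_le (Finset.mem_range.1 hk)
        push_cast
        linarith
    _ = (⌈132 * Real.log M⌉₊ : ℝ) * (64 * Real.sqrt (I.LPsi / I.μ) * Real.log M) := by
        rw [Finset.sum_const, Finset.card_range, nsmul_eq_mul]
    _ ≤ (133 * Real.log M) * (64 * Real.sqrt (I.LPsi / I.μ) * Real.log M) := by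
        gcongr
        have := (Nat.ceil_lt_add_one (show 0 ≤ 132 * Real.log M by linarith)).le
        linarith
    _ = _ := by ring

/-- The primal error after all outer iterations. -/
theorem primal_error_final (W : I.WellConditioned G xe lamS M) :
    ‖(I.iter ⌈132 * Real.log M⌉₊).1 - xe‖ ≤ I.D / (27 * M) := by
  have hM := W.M_pos
  have hM3 := W.three_le
  have hlog := W.one_le_log
  have hD := W.D_pos
  have hT := Nat.le_ceil (132 * Real.log M)
  obtain ⟨k, hk⟩ : ∃ k, ⌈132 * Real.log M⌉₊ = k + 1 :=
    Nat.exists_eq_succ_of_ne_zero (Nat.ceil_pos.2 (by positivity)).ne'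
  rw [hk] at hT ⊢
  -- The constant is `132 = 12 · 11`: each step gains `exp (-1/12)`. Of the eleven powers of `M`,
  -- two absorb `M² + 6 ≤ 2 M²`, two remain in the bound, and seven yield the numerical factor.
  have hq : (11 / 12 : ℝ) ^ (k + 1) ≤ 1 / M ^ 11 := by
    have h1 : (11 / 12 : ℝ) ≤ Real.exp (-(1 / 12)) := by
      have := Real.add_one_le_exp (-(1 / 12) : ℝ)
      linarith
    calc (11 / 12 : ℝ) ^ (k + 1) ≤ Real.exp (-(1 / 12)) ^ (k + 1) := by gcongr
      _ = Real.exp (((k + 1 : ℕ) : ℝ) * -(1 / 12)) := (Real.exp_nat_mul _ _).symm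
      _ ≤ Real.exp (-((11 : ℕ) * Real.log M)) := by
          refine Real.exp_le_exp.2 ?_
          push_cast at hT ⊢
          linarith
      _ = 1 / M ^ 11 := by rw [Real.exp_neg, Real.exp_nat_mul, Real.exp_log hM, one_div]
  have hq' : (11 / 12 : ℝ) ^ k ≤ 12 / 11 * (1 / M ^ 11) := by
    rw [pow_succ] at hq
    linarith
  refine le_of_sq_le_sq ?_ (by positivity)
  have h81 : (3 : ℝ) ^ 7 ≤ M ^ 7 := pow_le_pow_left₀ (by norm_num) hM3 7
  calc _ ≤ _ := W.primal_error_le k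
    _ ≤ 12 / 11 * (1 / M ^ 11) * ((2 * M ^ 2) * I.D ^ 2) := by
        gcongr
        nlinarith
    _ = 24 / 11 * I.D ^ 2 / (M ^ 2 * M ^ 7) := by field_simp; norm_num
    _ ≤ 24 / 11 * I.D ^ 2 / (M ^ 2 * 3 ^ 7) := by gcongr
    _ = I.D ^ 2 / M ^ 2 * (24 / 11 / 3 ^ 7) := by ring
    _ ≤ I.D ^ 2 / M ^ 2 * (1 / 27 ^ 2) :=
        mul_le_mul_of_nonneg_left (by norm_num) (by positivity)
    _ = _ := by field_simp

end WellConditioned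

end PPAInput

/-! ### The regularized problem and the final estimates -/

section Main

variable {n m : ℕ}

/-- The surrogate is bounded by `h` up to a Lipschitz error. -/
theorem surrogate_le {h : Vec m → EReal} {z : Vec m} {a ρ : ℝ} (hz : h z = a) (w : Vec m) :
    surrogate h ρ w ≤ ((a + ρ * ‖w - z‖ : ℝ) : EReal) := by
  refine iSup₂_le fun y hy => ?_
  rw [mem_closedBall_zero_iff] at hy
  refine (EReal.sub_le_sub le_rfl (le_conj (y := y) hz.le)).trans ?_
  rw [← EReal.coe_sub, EReal.coe_le_coe_iff]
  have h1 := real_inner_le_norm (w - z) y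
  rw [inner_sub_left] at h1
  have h2 := mul_le_mul_of_nonneg_left hy (norm_nonneg (w - z))
  linarith

/-- The suboptimality of a point near a point with small objective value. -/
theorem subOptC_le {f : Vec n → ℝ} {h : Vec m → EReal} {A : Vec n →L[ℝ] Vec m} {b : Vec m}
    {Lf ρ a r e : ℝ} (hf : IsSmooth Lf f) (hρ : 0 ≤ ρ) {xstar xe x : Vec n}
    (hmin : IsMinOn (objective f h A b) Set.univ xstar) (hr : objective f h A b xstar = r)
    (ha : h (A xe - b) = a)
    (hle : f xe + a + (‖gradient f xe‖ + ρ * ‖A‖) * ‖x - xe‖ + Lf / 2 * ‖x - xe‖ ^ 2 ≤ r + e) :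
    subOptC f h A b ρ x ≤ e := by
  have hinf : ⨅ x', objective f h A b x' = r := by
    rw [← hr]
    exact le_antisymm (iInf_le _ _) (le_iInf fun x' => hmin (Set.mem_univ x'))
  have h1 := surrogate_le (ρ := ρ) ha (A x - b)
  rw [sub_sub_sub_cancel_right, ← map_sub] at h1
  have h2 := descent_lemma (fun x => (hf.1 x).hasGradientAt) hf.2 xe x
  have h3 := real_inner_le_norm (gradient f xe) (x - xe)
  have h4 := mul_le_mul_of_nonneg_left (A.le_opNorm (x - xe)) hρ
  rw [subOptC, hinf]
  refine (EReal.sub_le_sub (add_le_add_right h1 _) le_rfl).trans ?_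
  rw [← EReal.coe_add, ← EReal.coe_sub, EReal.coe_le_coe_iff]
  linarith

theorem exists_objective_eq_coe {f : Vec n → ℝ} {h : Vec m → EReal} {A : Vec n →L[ℝ] Vec m}
    {b : Vec m} (hh : ProperClosedConvex h) (hA : Function.Surjective A) {xstar : Vec n}
    (hmin : IsMinOn (objective f h A b) Set.univ xstar) :
    ∃ a : ℝ, h (A xstar - b) = a := by
  obtain ⟨z, hz⟩ := hh.exists_ne_top
  obtain ⟨x, hx⟩ := hA (z + b)
  refine exists_coe_of_ne (hh.ne_bot _) fun htop => ?_
  have h1 := hmin (Set.mem_univ x)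
  rw [Set.mem_ofPred_eq, objective, objective, htop, hx, add_sub_cancel_right,
    EReal.coe_add_top, top_le_iff] at h1
  obtain ⟨r, hr⟩ := exists_coe_of_ne (hh.ne_bot z) hz
  rw [hr, ← EReal.coe_add] at h1
  exact EReal.coe_ne_top _ h1

variable {f : Vec n → ℝ} {h : Vec m → EReal} {A : Vec n →L[ℝ] Vec m} {b : Vec m}
  {x₀ xstar : Vec n} {lam₀ : Vec m} {Lf D ε ρ : ℝ}

/-- The minimizer and multiplier of the regularized problem. -/
theorem exists_regularized_saddle_point (hconv : ConvexOn ℝ Set.univ f) (hLf : 0 ≤ Lf)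
    (hf : IsSmooth Lf f) (hh : ProperClosedConvex h) (hA : Function.Surjective A)
    (hmin : IsMinOn (objective f h A b) Set.univ xstar) (hx₀ : ‖x₀ - xstar‖ ≤ D) (hD : 0 < D)
    (hε : 0 < ε) :
    ∃ (xe : Vec n) (lamS : Vec m) (a r : ℝ), ‖x₀ - xe‖ ≤ D ∧
      gradient f xe + (ε / D ^ 2) • (xe - x₀) + ContinuousLinearMap.adjoint A lamS = 0 ∧
      IsSubgradient h (A xe - b) lamS ∧ h (A xe - b) = a ∧
      objective f h A b xstar = r ∧ f xe + a ≤ r + ε / 2 := by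
  obtain ⟨s, hs⟩ := exists_objective_eq_coe hh hA hmin
  have hr : objective f h A b xstar = ((f xstar + s : ℝ) : EReal) := by
    rw [objective, hs, EReal.coe_add]
  have hμ : 0 < ε / D ^ 2 := by positivity
  have hS := SmoothStronglyConvex.regularize (μ := ε / D ^ 2) hconv
    (fun x => (hf.1 x).hasGradientAt) hf.2 x₀
  have hsplit : ∀ x, objective (fun x => f x + ε / D ^ 2 / 2 * ‖x - x₀‖ ^ 2) h A b x
      = objective f h A b x + ((ε / D ^ 2 / 2 * ‖x - x₀‖ ^ 2 : ℝ) : EReal) := by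
    intro x
    rw [objective, objective, EReal.coe_add, add_right_comm]
  obtain ⟨xe, lamS, hxe, hstat, hsub⟩ := exists_saddle_point hS (by positivity) hh hA b
    (x₀ := x₀) (B := f xstar + s) (half_pos hμ) (fun x => by
      rw [hsplit, EReal.coe_add, ← hr]
      gcongr
      exact hmin (Set.mem_univ x))
  obtain ⟨a, ha, -⟩ := id hsub
  have h1 := hmin (Set.mem_univ xe)
  have h2 := hxe (Set.mem_univ xstar)
  rw [Set.mem_ofPred_eq, hr, objective, ha, ← EReal.coe_add, EReal.coe_le_coe_iff] at h1
  rw [Set.mem_ofPred_eq, hsplit, hsplit, hr, objective, ha, ← EReal.coe_add, ← EReal.coe_add,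
    ← EReal.coe_add, EReal.coe_le_coe_iff] at h2
  rw [norm_sub_rev] at hx₀
  -- `xstar` is optimal without the penalty and `xe` with it, so `xe` cannot have the larger
  -- penalty.
  have h3 : ‖xe - x₀‖ ≤ ‖xstar - x₀‖ := by
    refine le_of_sq_le_sq ?_ (norm_nonneg _)
    refine le_of_mul_le_mul_left ?_ (half_pos hμ)
    linarith
  refine ⟨xe, lamS, a, f xstar + s, by rw [norm_sub_rev]; exact h3.trans hx₀, hstat, hsub, ha, hr,
    ?_⟩
  have h4 : ε / D ^ 2 / 2 * ‖xstar - x₀‖ ^ 2 ≤ ε / D ^ 2 / 2 * D ^ 2 := by gcongr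
  have h5 : ε / D ^ 2 / 2 * D ^ 2 = ε / 2 := by field_simp
  have h6 : 0 ≤ ε / D ^ 2 / 2 * ‖xe - x₀‖ ^ 2 := by positivity
  linarith

/-- The choice `ℓ = σ_min²/L` gives `‖A‖²/ℓ = L κ_A²`, which is the source of the factor `κ_A` in
the complexity. -/
theorem regularizedInput_ratio (hm : 0 < m) (hA : Function.Surjective A) (hLf : 0 ≤ Lf)
    (hD : 0 < D) (hε : 0 < ε) :
    (regularizedInput f h A b x₀ lam₀ Lf D ε).LPsi / (regularizedInput f h A b x₀ lam₀ Lf D ε).μ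
      = (Lf * D ^ 2 / ε + 1) * (1 + condNumber A ^ 2) := by
  have hσ := sigmaMin_pos hm hA
  have hL : 0 < Lf + ε / D ^ 2 := by positivity
  simp only [PPAInput.LPsi, regularizedInput, condNumber]
  field_simp

theorem regularizedInput_wellConditioned (hm : 0 < m) (hconv : ConvexOn ℝ Set.univ f)
    (hLf : 0 ≤ Lf) (hf : IsSmooth Lf f) (hh : ProperClosedConvex h) (hA : Function.Surjective A)
    (hD : 0 < D) (hε : 0 < ε) (hρ : 0 < ρ) {xe : Vec n} {lamS : Vec m} (hxe : ‖x₀ - xe‖ ≤ D)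
    (hstat : gradient f xe + (ε / D ^ 2) • (xe - x₀) + ContinuousLinearMap.adjoint A lamS = 0)
    (hsub : IsSubgradient h (A xe - b) lamS) :
    (regularizedInput f h A b x₀ lam₀ Lf D ε).WellConditioned
      (fun x => gradient f x + (ε / D ^ 2) • (x - x₀)) xe lamS
      (logArg f A x₀ lam₀ Lf D ε ρ) := by
  have hμ : 0 < ε / D ^ 2 := by positivity
  have hσ := sigmaMin_pos hm hA
  have hκ := one_le_condNumber hm hA
  set R := Lf * D ^ 2 / ε with hR
  have hR0 : 0 ≤ R := by positivity
  set S := ‖gradient f x₀‖ + ρ * ‖A‖ + ‖A‖ * ‖lam₀‖ with hS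
  have hSD : 0 ≤ S * D / ε := by positivity
  have hM : logArg f A x₀ lam₀ Lf D ε ρ = 2 + condNumber A + R + S * D / ε := rfl
  have hlip : ∀ x y, ‖(gradient f x + (ε / D ^ 2) • (x - x₀))
      - (gradient f y + (ε / D ^ 2) • (y - x₀))‖ ≤ (Lf + ε / D ^ 2) * ‖x - y‖ := by
    intro x y
    rw [add_sub_add_comm, ← smul_sub, sub_sub_sub_cancel_right, add_mul]
    refine (norm_add_le _ _).trans (add_le_add (hf.2 x y) ?_)
    rw [norm_smul, Real.norm_of_nonneg hμ.le]
  have hLμ : (Lf + ε / D ^ 2) / (ε / D ^ 2) = R + 1 := by rw [hR]; field_simp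
  have hsmooth := SmoothStronglyConvex.regularize (μ := ε / D ^ 2) hconv
      (fun x => (hf.1 x).hasGradientAt) hf.2 x₀
  rw [show ε / D ^ 2 / 2 = ε / (2 * D ^ 2) by field_simp] at hsmooth
  refine
    { smooth := hsmooth
      lipschitz := hlip
      conj := conj_closedConvexSubdifferentiable hh.ne_bot hsub
      mu_pos := hμ
      mu_le := le_add_of_nonneg_left hLf
      sigma_pos := hσ
      sigma_le := sigmaMin_mul_norm_le_adjoint hm hA
      ell_eq := rfl
      D_pos := hD
      stationary := hstat
      subgradient := hsub.conj hh.ne_bot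
      three_le := by rw [hM]; linarith
      ratio_le := ?_
      cond_le := by change condNumber A ≤ _; rw [hM]; linarith
      sqrt_ratio_le := ?_
      primal_le := hxe
      dual_le := ?_ }
  · change (Lf + ε / D ^ 2) / (ε / D ^ 2) ≤ _
    rw [hLμ, hM]
    linarith
  · rw [regularizedInput_ratio hm hA hLf hD hε, Real.sq_sqrt (by positivity)]
    calc (R + 1) * (1 + condNumber A ^ 2)
        ≤ logArg f A x₀ lam₀ Lf D ε ρ * logArg f A x₀ lam₀ Lf D ε ρ ^ 2 := by
          rw [hM]
          refine mul_le_mul (by linarith) ?_ (by positivity) (by positivity)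
          calc 1 + condNumber A ^ 2 ≤ (2 + condNumber A) ^ 2 := by nlinarith
            _ ≤ _ := pow_le_pow_left₀ (by positivity) (by linarith) 2
      _ = _ := by ring
  · change sigmaMin A * ‖lam₀ - lamS‖ ≤ logArg f A x₀ lam₀ Lf D ε ρ * (ε / D ^ 2) * D
    have h1 := sigmaMin_mul_norm_le_adjoint hm hA (lam₀ - lamS)
    -- Stationarity expresses `Aᵀ lamS` through the gradient at `xe`, so the multiplier is bounded
    -- without reference to `ρ`.
    have h2 : ContinuousLinearMap.adjoint A (lam₀ - lamS)
        = ContinuousLinearMap.adjoint A lam₀ + (gradient f xe + (ε / D ^ 2) • (xe - x₀)) := by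
      rw [map_sub, eq_neg_of_add_eq_zero_left hstat]; abel
    have h3 := hlip xe x₀
    rw [sub_self, smul_zero, add_zero, norm_sub_rev xe x₀] at h3
    have h4 : ‖gradient f xe + (ε / D ^ 2) • (xe - x₀)‖
        ≤ (Lf + ε / D ^ 2) * D + ‖gradient f x₀‖ := by
      refine (norm_le_norm_sub_add _ (gradient f x₀)).trans ?_
      gcongr
      exact h3.trans (by gcongr)
    rw [h2] at h1
    have h5 := h1.trans ((norm_add_le _ _).trans (add_le_add (norm_adjoint_apply_le A lam₀) h4))
    refine h5.trans ?_
    have h6 : logArg f A x₀ lam₀ Lf D ε ρ * (ε / D ^ 2) * D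
        = (1 + condNumber A) * (ε / D) + (Lf + ε / D ^ 2) * D + S := by
      rw [hM, hR]; field_simp; ring
    have h7 : 0 ≤ (1 + condNumber A) * (ε / D) := by positivity
    have h8 : 0 ≤ ρ * ‖A‖ := by positivity
    rw [h6, hS]
    linarith

/-- The numerical estimate behind the suboptimality bound. -/
theorem suboptimality_estimate {g S Lf D ε M d : ℝ} (hS : 0 ≤ S)
    (hLf : 0 ≤ Lf) (hD : 0 < D) (hε : 0 < ε) (hM : 3 ≤ M) (hd0 : 0 ≤ d) (hd : d ≤ D / (27 * M))
    (hg : g ≤ S + Lf * D) (hMS : S * D / ε + Lf * D ^ 2 / ε ≤ M) :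
    g * d + Lf / 2 * d ^ 2 ≤ ε / 2 := by
  have hM0 : 0 < M := by linarith
  have h1 : (S + Lf * D) * D ≤ M * ε := by
    rw [← add_div, div_le_iff₀ hε] at hMS
    linarith
  have h2 : d ≤ D := hd.trans (div_le_self hD.le (by linarith))
  calc g * d + Lf / 2 * d ^ 2 ≤ (S + Lf * D) * d + Lf / 2 * (D * d) := by
        rw [pow_two]
        gcongr
    _ ≤ 2 * (S + Lf * D) * d := by
        have : 0 ≤ Lf * D * d := by positivity
        have : 0 ≤ S * d := by positivity
        linarith
    _ ≤ 2 * (S + Lf * D) * (D / (27 * M)) := by gcongr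
    _ = 2 * ((S + Lf * D) * D) / (27 * M) := by ring
    _ ≤ 2 * (M * ε) / (27 * M) := by gcongr
    _ = 2 / 27 * ε := by field_simp
    _ ≤ ε / 2 := by linarith

theorem sqrt_ratio_le {κ R : ℝ} (hκ : 1 ≤ κ) :
    Real.sqrt ((R + 1) * (1 + κ ^ 2)) ≤ 2 * (κ * Real.sqrt (R + 1)) := by
  have h1 : Real.sqrt (1 + κ ^ 2) ≤ 2 * κ := by
    rw [Real.sqrt_le_left (by linarith)]
    nlinarith
  rw [Real.sqrt_mul' _ (by positivity)]
  nlinarith [Real.sqrt_nonneg (R + 1)]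

theorem sqrt_add_one_le (hLf : 0 ≤ Lf) (hD : 0 < D) (hε : 0 < ε) (hle : ε ≤ Lf * D ^ 2) :
    Real.sqrt (Lf * D ^ 2 / ε + 1) ≤ 2 * (Real.sqrt Lf * D / Real.sqrt ε) := by
  rw [Real.sqrt_le_left (by positivity), mul_pow, div_pow, mul_pow, Real.sq_sqrt hLf,
    Real.sq_sqrt hε.le]
  have := (one_le_div hε).2 hle
  linarith

end Main

end CompositeOpt

theorem mainTheorem3 :
    ∃ C₁ : ℝ, 0 < C₁ ∧ ∃ C₂ : ℝ, 0 < C₂ ∧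
      ∀ (n m : ℕ) (f : CompositeOpt.Vec n → ℝ) (h : CompositeOpt.Vec m → EReal)
        (A : CompositeOpt.Vec n →L[ℝ] CompositeOpt.Vec m) (b : CompositeOpt.Vec m)
        (x₀ xstar : CompositeOpt.Vec n) (lam₀ : CompositeOpt.Vec m) (Lf D ε ρ : ℝ),
        0 < m →
        ConvexOn ℝ Set.univ f →
        0 ≤ Lf →
        CompositeOpt.IsSmooth Lf f →
        CompositeOpt.ProperClosedConvex h →
        Function.Surjective A →
        IsMinOn (CompositeOpt.objective f h A b) Set.univ xstar →
        ‖x₀ - xstar‖ ≤ D →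
        0 < D → 0 < ε → 0 < ρ →
        let I := CompositeOpt.regularizedInput f h A b x₀ lam₀ Lf D ε
        let ℒ := Real.log (CompositeOpt.logArg f A x₀ lam₀ Lf D ε ρ)
        let T := ⌈C₁ * ℒ⌉₊
        -- one evaluation of `∇Ψ` costs one evaluation of `∇f`
        (∀ (lam : CompositeOpt.Vec m) (x : CompositeOpt.Vec n),
          HasGradientAt (I.Psi lam)
            (gradient f x + (ε / D ^ 2) • (x - x₀)
              + ContinuousLinearMap.adjoint A (I.dualStep lam x)) x) ∧
        (∀ k < T, I.InnerTerminates k) ∧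
        CompositeOpt.subOptC f h A b ρ (I.iter T).1 ≤ (ε : EReal) ∧
        (I.gradEvals T : ℝ)
          ≤ C₂ * (CompositeOpt.condNumber A * Real.sqrt (Lf * D ^ 2 / ε + 1)) * ℒ ^ 2 ∧
        (ε ≤ Lf * D ^ 2 →
          (I.gradEvals T : ℝ)
            ≤ C₂ * (CompositeOpt.condNumber A * Real.sqrt Lf * D / Real.sqrt ε) * ℒ ^ 2) := by
  -- `34048 = 8512 · 2 · 2`: one factor `2` comes from `√(1 + κ_A²) ≤ 2 κ_A`, the other from
  -- absorbing the `+ 1` under the root when `ε ≤ L_f D²`.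
  refine ⟨132, by norm_num, 34048, by norm_num, ?_⟩
  intro n m f h A b x₀ xstar lam₀ Lf D ε ρ hm hconv hLf hf hh hA hmin hx₀ hD hε hρ I ℒ T
  obtain ⟨xe, lamS, a, r, hxe, hstat, hsub, ha, hr, hval⟩ :=
    CompositeOpt.exists_regularized_saddle_point hconv hLf hf hh hA hmin hx₀ hD hε
  have W := CompositeOpt.regularizedInput_wellConditioned (lam₀ := lam₀) hm hconv hLf hf hh hA hD
    hε hρ hxe hstat hsub
  have hκ := CompositeOpt.one_le_condNumber hm hA
  have hevals : (I.gradEvals T : ℝ)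
      ≤ 17024 * (CompositeOpt.condNumber A * Real.sqrt (Lf * D ^ 2 / ε + 1)) * ℒ ^ 2 := by
    refine W.gradEvals_le.trans ?_
    rw [CompositeOpt.regularizedInput_ratio hm hA hLf hD hε]
    have h1 := CompositeOpt.sqrt_ratio_le (R := Lf * D ^ 2 / ε) hκ
    refine mul_le_mul_of_nonneg_right ?_ (sq_nonneg ℒ)
    linarith
  refine ⟨fun lam x => (W.Psi_smooth lam).hasGradientAt x, fun k _ => W.innerTerminates k, ?_,
    hevals.trans ?_, fun hle => hevals.trans ?_⟩
  · refine CompositeOpt.subOptC_le hf hρ.le hmin hr ha ?_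
    have hgrad : ‖gradient f xe‖ ≤ ‖gradient f x₀‖ + Lf * D := by
      have h1 := norm_le_norm_sub_add (gradient f xe) (gradient f x₀)
      have h2 := hf.2 xe x₀
      rw [norm_sub_rev xe x₀] at h2
      have h3 := mul_le_mul_of_nonneg_left hxe hLf
      linarith
    have hest := CompositeOpt.suboptimality_estimate (S := ‖gradient f x₀‖ + ρ * ‖A‖)
      (g := ‖gradient f xe‖ + ρ * ‖A‖) (by positivity) hLf hD hε W.three_le (norm_nonneg _)
      W.primal_error_final (by linarith) (by
        rw [CompositeOpt.logArg, add_mul _ (‖A‖ * ‖lam₀‖), add_div]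
        have : 0 ≤ ‖A‖ * ‖lam₀‖ * D / ε := by positivity
        linarith)
    change f xe + a + (‖gradient f xe‖ + ρ * ‖A‖) * ‖(I.iter T).1 - xe‖
      + Lf / 2 * ‖(I.iter T).1 - xe‖ ^ 2 ≤ r + ε
    linarith
  · gcongr
    norm_num
  · refine mul_le_mul_of_nonneg_right ?_ (sq_nonneg ℒ)
    have h1 := CompositeOpt.sqrt_add_one_le hLf hD hε hle
    calc 17024 * (CompositeOpt.condNumber A * Real.sqrt (Lf * D ^ 2 / ε + 1))
        ≤ 17024 * (CompositeOpt.condNumber A * (2 * (Real.sqrt Lf * D / Real.sqrt ε))) := by gcongr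
      _ = _ := by ring
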